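/- Let $k$ be an algebraically closed field of characteristic zero, $V$ a $k$-vector space of finite dimension $n$, and $R=\operatorname{Sym}(V^*)$. For a commutative $k$-algebra $S$ let $\operatorname{Hom}_k^{\mathrm{cont}}(S,k)$ be the $S$-module of all $k$-linear maps $\mu:S\to k$ that vanish on some ideal $I\subseteq S$ with $\dim_k S/I<\infty$, where $(s\mu)(x)=\mu(sx)$. It is a $k$-coalgebra with counit $\mu\mapsto\mu(1)$ and with the coproduct $\Delta$ characterized by $\Delta(\mu)(x\otimes y)=\mu(xy)$. (1) The canonical map $$\bigoplus_{\mathfrak m}\operatorname{Hom}_k^{\mathrm{cont}}(R_{\mathfrak m},k)\longrightarrow\operatorname{Hom}_k^{\mathrm{cont}}(R,k),$$ where $\mathfrak m$ ranges over the maximal ideals of $R$ and each summand is mapped by restriction along $R\to R_{\mathfrak m}$, is an isomorphism of $R$-modules. (2) Choose any basis of $V$, with dual basis $x_1,\dots,x_n$ of $V^*$. For $P\in V$ put $z_i=x_i-x_i(P)$, so that $\mathfrak m_P=(z_1,\dots,z_n)$ is the maximal ideal of $P$, and let $H_P=H^n_{\mathfrak m_P}(R,\Omega^n_{R/k})$ be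 the local cohomology module, presented as the top cohomology of the Čech complex of $\Omega^n_{R/k}$ for $z_1,\dots,z_n$. Let $\operatorname{Res}_P:H_P\to k$ be the residue, which takes the class of $\frac{f}{z_1^{c_1}\cdots z_n^{c_n}}\,dz_1\wedge\cdots\wedge dz_n$, for $f\in R$, to the coefficient of $(z_1\cdots z_n)^{-1}$ in $\frac{f}{z_1^{c_1}\cdots z_n^{c_n}}$ expanded as a Laurent polynomial in the $z_i$. The classes $F_a$ of $\frac{dz_1\wedge\cdots\wedge dz_n}{z_1^{a_1+1}\cdots z_n^{a_n+1}}$, $a\in\mathbb N^n$, form a $k$-basis of $H_P$, and $H_P$ is a coalgebra with counit $\operatorname{Res}_P$ and coproduct $\Delta F_a=\sum_{c+d=a}F_c\otimes F_d$. Let ${!}V=\bigoplus_{P\in V}H_P$ be the direct sum of these coalgebras and $\operatorname{Res}=\sum_P\operatorname{Res}_P:{!}V\to k$. Then $${!}V\longrightarrow\operatorname{Hom}_k^{\mathrm{cont}}(R,k),\qquad \eta\longmapsto\operatorname{Res}((-)\cdot\eta)$$ is well defined and an isomorphism of $k$-coalgebras. -/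

import Mathlib

open scoped TensorProduct DirectSum

namespace CofreeCoalgebra

section ContinuousDual

variable (k S : Type*) [Field k] [CommRing S] [Algebra k S]

/-- `Hom_k^cont(S, k)`: the linear functionals on the `k`-algebra `S` that vanish on an ideal of
finite codimension. -/
def contDual : Submodule k (Module.Dual k S) where
  carrier := {μ | ∃ I : Ideal S, FiniteDimensional k (S ⧸ I) ∧ ∀ x ∈ I, μ x = 0}
  zero_mem' := ⟨⊤, inferInstance, fun _ _ => rfl⟩
  add_mem' := by
    rintro μ ν ⟨I, hI, hμ⟩ ⟨J, hJ, hν⟩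
    refine ⟨I ⊓ J, ?_, fun x hx => by simp [hμ x hx.1, hν x hx.2]⟩
    let f : S →ₗ[k] (S ⧸ I) × (S ⧸ J) :=
      (Ideal.Quotient.mkₐ k I).toLinearMap.prod (Ideal.Quotient.mkₐ k J).toLinearMap
    have hf : (Submodule.restrictScalars k (I ⊓ J)) = LinearMap.ker f := by
      ext x
      simp [f, Ideal.Quotient.eq_zero_iff_mem]
    have : FiniteDimensional k (S ⧸ LinearMap.ker f) :=
      LinearEquiv.finiteDimensional f.quotKerEquivRange.symm
    rw [← hf] at this
    exact this
  smul_mem' := by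
    rintro c μ ⟨I, hI, hμ⟩
    exact ⟨I, hI, fun x hx => by simp [hμ x hx]⟩

/-- `Hom_k^cont(S, k)` as a type. -/
def ContDual : Type _ := contDual k S

noncomputable instance : AddCommGroup (ContDual k S) :=
  inferInstanceAs (AddCommGroup (contDual k S))

noncomputable instance : Module k (ContDual k S) :=
  inferInstanceAs (Module k (contDual k S))

/-- The inclusion of `Hom_k^cont(S, k)` into the dual space of `S`. -/
noncomputable def ContDual.incl : ContDual k S →ₗ[k] Module.Dual k S := (contDual k S).subtype

variable {k S}

theorem ContDual.incl_injective : Function.Injective (ContDual.incl k S) :=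
  Subtype.val_injective

/-- Elements of `Hom_k^cont(S, k)` are functions on `S`. -/
noncomputable instance : CoeFun (ContDual k S) (fun _ => S → k) where
  coe μ := ContDual.incl k S μ

/-- The `S`-module structure on `Hom_k^cont(S, k)`: `(a • μ)(x) = μ (a x)`. -/
instance : Module S (ContDual k S) where
  smul a μ := ⟨μ.1 ∘ₗ LinearMap.mulLeft k a, by
    obtain ⟨I, hI, h⟩ := μ.2
    exact ⟨I, hI, fun x hx => h _ (I.mul_mem_left a hx)⟩⟩
  one_smul μ := Subtype.ext (LinearMap.ext fun x => congrArg μ.1 (one_mul x))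
  mul_smul a b μ := Subtype.ext (LinearMap.ext fun x =>
    congrArg μ.1 (show a * b * x = b * (a * x) by ring))
  smul_zero a := rfl
  smul_add a μ ν := rfl
  add_smul a b μ := Subtype.ext (LinearMap.ext fun x =>
    (congrArg μ.1 (add_mul a b x)).trans (map_add μ.1 _ _))
  zero_smul μ := Subtype.ext (LinearMap.ext fun x =>
    (congrArg μ.1 (zero_mul x)).trans (map_zero μ.1))

variable {T : Type*} [CommRing T] [Algebra k T]

theorem comp_mem_contDual (f : S →ₐ[k] T) (μ : ContDual k T) :
    ContDual.incl k T μ ∘ₗ f.toLinearMap ∈ contDual k S := by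
  obtain ⟨μ, I, hI, h⟩ := μ
  refine ⟨I.comap f, ?_, fun x hx => h _ hx⟩
  exact Module.Finite.of_injective
    (Ideal.quotientMapₐ I f (le_refl (I.comap f))).toLinearMap
    (Ideal.quotientMap_injective (f := f.toRingHom) (I := I))

/-- `Hom_k^cont(S_𝔭, k)` is an `S`-module by restriction of scalars along `S → S_𝔭`. -/
noncomputable instance (p : Ideal S) [p.IsPrime] :
    Module S (ContDual k (Localization.AtPrime p)) :=
  Module.compHom _ (algebraMap S (Localization.AtPrime p))

/-- Restriction of continuous functionals along `S → S_𝔭`. -/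
noncomputable def restrictCont (p : Ideal S) [p.IsPrime] :
    ContDual k (Localization.AtPrime p) →ₗ[S] ContDual k S where
  toFun μ := ⟨_, comp_mem_contDual (IsScalarTower.toAlgHom k S (Localization.AtPrime p)) μ⟩
  map_add' _ _ := rfl
  map_smul' a μ := Subtype.ext (LinearMap.ext fun x =>
    congrArg μ (map_mul (algebraMap S (Localization.AtPrime p)) a x).symm)

variable (k S) in
/-- The canonical map `⨁_𝔪 Hom_k^cont(S_𝔪, k) → Hom_k^cont(S, k)`, the sum over the maximal
ideals `𝔪` of `S` of the restriction maps along `S → S_𝔪`. -/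
noncomputable def decompMap [DecidableEq (MaximalSpectrum S)] :
    (⨁ m : MaximalSpectrum S, ContDual k (Localization.AtPrime m.asIdeal)) →ₗ[S] ContDual k S :=
  DirectSum.toModule S _ _ fun m => restrictCont m.asIdeal

theorem dualDistrib_injective (V W : Type*) [AddCommGroup V] [Module k V] [AddCommGroup W]
    [Module k W] : Function.Injective (TensorProduct.dualDistrib k V W) := by
  classical
  rw [injective_iff_map_eq_zero]
  intro t ht
  let b := Module.Basis.ofVectorSpace k (Module.Dual k V)
  let e := TensorProduct.equivFinsuppOfBasisLeft (N := Module.Dual k W) b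
  obtain ⟨c, rfl⟩ := e.symm.surjective t
  have key : ∀ y : W, ∀ i, c i y = 0 := by
    intro y
    have h0 : ∑ i ∈ c.support, c i y • b i = 0 := by
      ext x
      have := LinearMap.congr_fun ht (x ⊗ₜ y)
      simpa [e, Finsupp.sum, mul_comm] using this
    intro i
    by_cases hi : i ∈ c.support
    · exact linearIndependent_iff'.1 b.linearIndependent _ _ h0 i hi
    · simp [Finsupp.notMem_support_iff.1 hi]
  have : c = 0 := by
    ext i y
    exact key y i
  simp [this]

variable (k S) in
/-- The pairing `(μ ⊗ ν)(x ⊗ y) = μ(x) ν(y)`. -/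
noncomputable def contPairing :
    ContDual k S ⊗[k] ContDual k S →ₗ[k] Module.Dual k (S ⊗[k] S) :=
  TensorProduct.dualDistrib k S S ∘ₗ
    TensorProduct.map (ContDual.incl k S) (ContDual.incl k S)

theorem contPairing_injective : Function.Injective (contPairing k S) := by
  unfold contPairing
  rw [LinearMap.coe_comp]
  exact (dualDistrib_injective S S).comp
    (TensorProduct.map_injective_of_flat_flat _ _
      ContDual.incl_injective ContDual.incl_injective)

variable (k S) in
/-- The functional `x ⊗ y ↦ μ (x y)` on `S ⊗ S`. -/
noncomputable def contMul : ContDual k S →ₗ[k] Module.Dual k (S ⊗[k] S) :=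
  (LinearMap.mul' k S).dualMap ∘ₗ ContDual.incl k S

theorem contMul_mem (μ : ContDual k S) :
    contMul k S μ ∈ LinearMap.range (contPairing k S) := by
  obtain ⟨μ, I, hI, h⟩ := μ
  let π := (Ideal.Quotient.mkₐ k I).toLinearMap
  let ν : Module.Dual k (S ⧸ I) := (Submodule.restrictScalars k I).liftQ μ h
  let q : Module.Dual k (S ⧸ I) →ₗ[k] ContDual k S :=
    π.dualMap.codRestrict (contDual k S) fun ν => ⟨I, hI, fun x hx => by
      simp [π, Ideal.Quotient.eq_zero_iff_mem.2 hx]⟩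
  obtain ⟨t, ht⟩ := (TensorProduct.dualDistribEquiv k (S ⧸ I) (S ⧸ I)).surjective
    (ν ∘ₗ LinearMap.mul' k (S ⧸ I))
  refine ⟨TensorProduct.map q q t, ?_⟩
  have h1 : ∀ t, contPairing k S (TensorProduct.map q q t) =
      TensorProduct.dualDistrib k (S ⧸ I) (S ⧸ I) t ∘ₗ TensorProduct.map π π := by
    intro t
    induction t with
    | zero => simp
    | add a b ha hb => simp [ha, hb, LinearMap.add_comp]
    | tmul a b =>
      ext x y
      simp [contPairing]
      rfl
  rw [h1]
  have ht' : TensorProduct.dualDistrib k (S ⧸ I) (S ⧸ I) t = ν ∘ₗ LinearMap.mul' k (S ⧸ I) := ht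
  rw [ht']
  ext x y
  simp [contMul, π, ν]
  rfl

variable (k S) in
/-- The coproduct of `Hom_k^cont(S, k)`: `Δ μ` is the unique tensor whose pairing with `x ⊗ y`
is `μ (x y)`. -/
noncomputable def contComul : ContDual k S →ₗ[k] ContDual k S ⊗[k] ContDual k S :=
  (LinearEquiv.ofInjective (contPairing k S) contPairing_injective).symm.toLinearMap ∘ₗ
    (contMul k S).codRestrict _ contMul_mem

theorem contPairing_contComul (μ : ContDual k S) :
    contPairing k S (contComul k S μ) = contMul k S μ := by
  have := (LinearEquiv.ofInjective (contPairing k S) contPairing_injective).apply_symm_apply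
    ((contMul k S).codRestrict _ contMul_mem μ)
  exact congrArg Subtype.val this

theorem contPairing_contComul_tmul (μ : ContDual k S) (x y : S) :
    contPairing k S (contComul k S μ) (x ⊗ₜ y) = μ (x * y) := by
  rw [contPairing_contComul]; simp [contMul]

/-- The coalgebra structure of `Hom_k^cont(S, k)`, dual to the multiplication and the unit of `S`;
the counit is `μ ↦ μ 1`. -/
noncomputable instance : Coalgebra k (ContDual k S) where
  comul := contComul k S
  counit := (Module.Dual.eval k S 1) ∘ₗ ContDual.incl k S
  coassoc := by
    let P3 : ContDual k S ⊗[k] (ContDual k S ⊗[k] ContDual k S) →ₗ[k]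
        Module.Dual k (S ⊗[k] (S ⊗[k] S)) :=
      TensorProduct.dualDistrib k S (S ⊗[k] S) ∘ₗ
        TensorProduct.map (ContDual.incl k S) (contPairing k S)
    have hP3 : Function.Injective P3 := by
      rw [LinearMap.coe_comp]
      exact (dualDistrib_injective S _).comp (TensorProduct.map_injective_of_flat_flat _ _
        ContDual.incl_injective contPairing_injective)
    have hl : ∀ t x y z, P3 ((contComul k S).lTensor _ t) (x ⊗ₜ (y ⊗ₜ z)) =
        contPairing k S t (x ⊗ₜ (y * z)) := by
      intro t x y z
      induction t with
      | zero => simp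
      | add a b ha hb => simp only [map_add, LinearMap.add_apply, ha, hb]
      | tmul a b =>
        simp [P3, contPairing_contComul_tmul]
        simp [contPairing]
    have hr : ∀ t x y z, P3 (TensorProduct.assoc k _ _ _ ((contComul k S).rTensor _ t))
        (x ⊗ₜ (y ⊗ₜ z)) = contPairing k S t ((x * y) ⊗ₜ z) := by
      intro t x y z
      induction t with
      | zero => simp
      | add a b ha hb => simp only [map_add, LinearMap.add_apply, ha, hb]
      | tmul a b =>
        have : ∀ u : ContDual k S ⊗[k] ContDual k S,
            P3 (TensorProduct.assoc k _ _ _ (u ⊗ₜ b)) (x ⊗ₜ (y ⊗ₜ z)) =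
              contPairing k S u (x ⊗ₜ y) * b z := by
          intro u
          induction u with
          | zero => simp
          | add a b ha hb => simp only [TensorProduct.add_tmul, map_add, LinearMap.add_apply, ha,
              hb, add_mul]
          | tmul c d => simp [P3, contPairing, mul_assoc]
        simp only [LinearMap.rTensor_tmul]
        rw [this, contPairing_contComul_tmul]
        simp [contPairing]
    ext μ
    apply hP3
    apply TensorProduct.ext
    ext x : 1
    apply TensorProduct.ext
    ext y z
    simp only [TensorProduct.mk_apply, LinearMap.comp_apply, LinearEquiv.coe_coe,
      LinearMap.compr₂ₛₗ_apply]
    rw [hl, hr, contPairing_contComul_tmul, contPairing_contComul_tmul, mul_assoc]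
  rTensor_counit_comp_comul := by
    ext μ : 1
    have : ∀ t y, (TensorProduct.lid k _ (((Module.Dual.eval k S 1) ∘ₗ
        ContDual.incl k S).rTensor _ t)) y = contPairing k S t (1 ⊗ₜ y) := by
      intro t y
      induction t with
      | zero => simp
      | add a b ha hb => simp only [map_add, LinearMap.add_apply, ← ha, ← hb, LinearMap.add_apply]
      | tmul a b => simp [contPairing]
    apply (TensorProduct.lid k _).injective
    apply ContDual.incl_injective
    ext y
    simp only [LinearMap.comp_apply]
    rw [this, contPairing_contComul_tmul]
    simp
  lTensor_counit_comp_comul := by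
    ext μ : 1
    have : ∀ t y, (TensorProduct.rid k _ (((Module.Dual.eval k S 1) ∘ₗ
        ContDual.incl k S).lTensor _ t)) y = contPairing k S t (y ⊗ₜ 1) := by
      intro t y
      induction t with
      | zero => simp
      | add a b ha hb => simp only [map_add, LinearMap.add_apply, ← ha, ← hb, LinearMap.add_apply]
      | tmul a b => simp [contPairing, mul_comm]
    apply (TensorProduct.rid k _).injective
    apply ContDual.incl_injective
    ext y
    simp only [LinearMap.comp_apply]
    rw [this, contPairing_contComul_tmul]
    simp

end ContinuousDual

section LocalCohomology

/-- The multiplicative set generated by the `z j` with `j ∈ J`. Localizing at it inverts the product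
of these elements. -/
def cechMonoid {A ι : Type*} [CommRing A] (z : ι → A) (J : Set ι) : Submonoid A :=
  Submonoid.closure (z '' J)

variable {A : Type*} [CommRing A] {n : ℕ} (z : Fin n → A) (M : Type*) [AddCommGroup M] [Module A M]

theorem isUnit_of_cechMonoid {ι : Type*} (z : ι → A) {N : Type*} [AddCommGroup N] [Module A N]
    (J : Set ι) (h : ∀ j ∈ J, IsUnit (algebraMap A (Module.End A N) (z j)))
    (x : cechMonoid z J) : IsUnit (algebraMap A (Module.End A N) x) := by
  obtain ⟨x, hx⟩ := x
  induction hx using Submonoid.closure_induction with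
  | mem x hx => obtain ⟨j, hj, rfl⟩ := hx; exact h j hj
  | one => simp
  | mul x y _ _ hx hy =>
    simp only [map_mul]
    exact IsUnit.mul hx hy

/-- The localization map `M_{z_1 ⋯ ẑ_i ⋯ z_n} → M_{z_1 ⋯ z_n}`. -/
noncomputable def cechFace (i : Fin n) :
    LocalizedModule (cechMonoid z {i}ᶜ) M →ₗ[A] LocalizedModule (cechMonoid z Set.univ) M :=
  LocalizedModule.lift _ (LocalizedModule.mkLinearMap _ M)
    (isUnit_of_cechMonoid z _ fun j _ =>
      IsLocalizedModule.map_units (S := cechMonoid z Set.univ)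
        (LocalizedModule.mkLinearMap (cechMonoid z Set.univ) M)
        ⟨z j, Submonoid.subset_closure ⟨j, trivial, rfl⟩⟩)

/-- The image of the last differential of the Čech complex of `M` for the sequence `z`: the sum of
the images of the `M_{z_1 ⋯ ẑ_i ⋯ z_n}` in `M_{z_1 ⋯ z_n}`. -/
noncomputable def cechBoundary : Submodule A (LocalizedModule (cechMonoid z Set.univ) M) :=
  ⨆ i, LinearMap.range (cechFace z M i)

/-- The top cohomology of the Čech complex of `M` for the sequence `z = (z_1, …, z_n)`, that is, the
cokernel of its last differential `⨁_i M_{z_1 ⋯ ẑ_i ⋯ z_n} → M_{z_1 ⋯ z_n}`. Over a noetherian ring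
it is the local cohomology module `H^n_I(M)` of `M` at the ideal `I = (z_1, …, z_n)`. -/
abbrev CechTop : Type _ := LocalizedModule (cechMonoid z Set.univ) M ⧸ cechBoundary z M

end LocalCohomology

section Residue

variable {k V : Type*} [Field k] [AddCommGroup V] [Module k V] {n : ℕ}

variable (k V) in
/-- The symmetric algebra `R = Sym(V^*)` of the dual space of `V`. -/
abbrev PolyRing : Type _ := SymmetricAlgebra k (Module.Dual k V)

variable (k V) in
/-- The `R`-module `Ω^n_{R/k}` of differential forms of degree `n`. -/
abbrev Forms (n : ℕ) : Type _ := ⋀[PolyRing k V]^n (Ω[PolyRing k V⁄k])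

variable (b : Module.Basis (Fin n) k V) (P : V)

/-- The linear coordinate `z_i = x_i - P_i` centred at `P`, where `x_1, …, x_n` is the basis of `V^*`
dual to `b`. These elements generate the maximal ideal `𝔪_P` of `R` corresponding to `P`. -/
noncomputable def localCoord (i : Fin n) : PolyRing k V :=
  SymmetricAlgebra.ι k (Module.Dual k V) (b.coord i) - algebraMap k (PolyRing k V) (b.coord i P)

/-- The form `dz_1 ∧ ⋯ ∧ dz_n`. -/
noncomputable def volForm : Forms k V n :=
  exteriorPower.ιMulti (PolyRing k V) n fun i =>
    KaehlerDifferential.D k (PolyRing k V) (localCoord b P i)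

/-- The local cohomology module `H^n_{𝔪_P}(R, Ω^n)`, `n = dim V`, computed by the Čech complex for
the generators `z_1, …, z_n` of `𝔪_P`. -/
def LC : Type _ := CechTop (localCoord b P) (Forms k V n)

noncomputable instance : AddCommGroup (LC b P) :=
  inferInstanceAs (AddCommGroup (CechTop (localCoord b P) (Forms k V n)))

noncomputable instance : Module (PolyRing k V) (LC b P) :=
  inferInstanceAs (Module (PolyRing k V) (CechTop (localCoord b P) (Forms k V n)))

noncomputable instance : Module k (LC b P) := Module.compHom _ (algebraMap k (PolyRing k V))

instance : IsScalarTower k (PolyRing k V) (LC b P) where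
  smul_assoc c r η := by
    rw [Algebra.smul_def, mul_smul]
    rfl

/-- The denominator `z_1 ^ (a_1 + 1) ⋯ z_n ^ (a_n + 1)`. -/
noncomputable def denom (a : Fin n →₀ ℕ) : cechMonoid (localCoord b P) Set.univ :=
  ∏ i, ⟨localCoord b P i, Submonoid.subset_closure ⟨i, trivial, rfl⟩⟩ ^ (a i + 1)

/-- The class in `H^n_{𝔪_P}(R, Ω^n)` of the meromorphic form `ω / s`. -/
noncomputable def LC.mk (ω : Forms k V n) (s : cechMonoid (localCoord b P) Set.univ) : LC b P :=
  (cechBoundary (localCoord b P) (Forms k V n)).mkQ (LocalizedModule.mk ω s)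

theorem LC.smul_mk (r : PolyRing k V) (ω : Forms k V n) (s) :
    r • LC.mk b P ω s = LC.mk b P (r • ω) s := by
  have h := LocalizedModule.smul'_mk (S := cechMonoid (localCoord b P) Set.univ) r ω s
  exact congrArg (cechBoundary (localCoord b P) (Forms k V n)).mkQ h

theorem LC.algebraMap_smul (c : k) (η : LC b P) :
    algebraMap k (PolyRing k V) c • η = c • η := rfl

theorem LC.mk_surjective (η : LC b P) : ∃ ω s, LC.mk b P ω s = η := by
  obtain ⟨x, rfl⟩ := (cechBoundary (localCoord b P) (Forms k V n)).mkQ_surjective η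
  induction x using LocalizedModule.induction_on with
  | h ω s => exact ⟨ω, s, rfl⟩

theorem LC.mk_cancel (t s : cechMonoid (localCoord b P) Set.univ) (ω : Forms k V n) :
    LC.mk b P ((t : PolyRing k V) • ω) (t * s) = LC.mk b P ω s :=
  congrArg (cechBoundary (localCoord b P) (Forms k V n)).mkQ
    (LocalizedModule.mk_cancel_common_left t s ω)

theorem LC.mk_eq_zero (i : Fin n) (ω : Forms k V n)
    (s : cechMonoid (localCoord b P) Set.univ)
    (hs : (s : PolyRing k V) ∈ cechMonoid (localCoord b P) {i}ᶜ) :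
    LC.mk b P ω s = 0 := by
  refine (Submodule.Quotient.mk_eq_zero _).2 (Submodule.mem_iSup_of_mem i ?_)
  let s' : cechMonoid (localCoord b P) {i}ᶜ := ⟨s, hs⟩
  refine ⟨LocalizedModule.mk ω s', ?_⟩
  refine IsLocalizedModule.smul_injective (S := cechMonoid (localCoord b P) Set.univ) (LocalizedModule.mkLinearMap (cechMonoid (localCoord b P) Set.univ) (Forms k V n)) s ?_
  have h1 : (s : PolyRing k V) • cechFace (localCoord b P) (Forms k V n) i
        (LocalizedModule.mk ω s') = LocalizedModule.mk ω 1 := by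
      rw [← map_smul, LocalizedModule.smul'_mk]
      have : LocalizedModule.mk ((s' : PolyRing k V) • ω) s' = LocalizedModule.mk ω 1 :=
        LocalizedModule.mk_cancel s' ω
      rw [this, cechFace, LocalizedModule.lift_mk_one]
      rfl
  refine h1.trans ?_
  refine Eq.symm ?_
  refine (LocalizedModule.smul'_mk _ _ _).trans ?_
  exact LocalizedModule.mk_cancel s ω

/-- The generalised fraction `[dz_1 ∧ ⋯ ∧ dz_n / z_1^{a_1+1}, …, z_n^{a_n+1}]`. -/
noncomputable def genFrac (a : Fin n →₀ ℕ) : LC b P :=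
  LC.mk b P (volForm b P) (denom b P a)

theorem derivation_ext {N : Type*} [AddCommGroup N] [Module (PolyRing k V) N] [Module k N]
    (D₁ D₂ : Derivation k (PolyRing k V) N)
    (h : ∀ i, D₁ (localCoord b P i) = D₂ (localCoord b P i)) : D₁ = D₂ := by
  have hι : ∀ f, D₁ (SymmetricAlgebra.ι k _ f) = D₂ (SymmetricAlgebra.ι k _ f) := by
    intro f
    have hf : f = ∑ i, f (b i) • b.coord i := by
      refine b.ext fun j => ?_
      simp
    have h' : ∀ i, D₁ (SymmetricAlgebra.ι k _ (b.coord i)) =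
        D₂ (SymmetricAlgebra.ι k _ (b.coord i)) := by
      intro i
      have := h i
      simpa only [localCoord, map_sub, Derivation.map_algebraMap, sub_zero] using this
    rw [hf]
    simp only [map_sum, map_smul, Derivation.map_smul, h']
  ext r
  induction r using SymmetricAlgebra.induction with
  | algebraMap c => simp
  | ι f => exact hι f
  | mul x y hx hy => simp [hx, hy]
  | add x y hx hy => simp [hx, hy]

/-- The derivation `∂/∂x_i` of `R`. -/
noncomputable def partialDeriv (i : Fin n) : Derivation k (PolyRing k V) (PolyRing k V) :=
  let e := SymmetricAlgebra.equivMvPolynomial b.dualBasis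
  Derivation.mk' (e.symm.toLinearMap ∘ₗ (MvPolynomial.pderiv i).toLinearMap ∘ₗ e.toLinearMap)
    fun x y => by
      simp [Derivation.leibniz]

theorem partialDeriv_localCoord (i j : Fin n) :
    partialDeriv b i (localCoord b P j) = if j = i then 1 else 0 := by
  have h1 : b.coord j = b.dualBasis j := by simp
  have h2 : partialDeriv b i (SymmetricAlgebra.ι k _ (b.coord j)) = if j = i then 1 else 0 := by
    rw [h1]
    change (SymmetricAlgebra.equivMvPolynomial b.dualBasis).symm (MvPolynomial.pderiv i
      (SymmetricAlgebra.equivMvPolynomial b.dualBasis (SymmetricAlgebra.ι k _ (b.dualBasis j)))) = _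
    rw [SymmetricAlgebra.equivMvPolynomial_ι_apply, MvPolynomial.pderiv_X]
    by_cases h : j = i
    · subst h; simp
    · simp [h]
  rw [localCoord, map_sub, h2, Derivation.map_algebraMap, sub_zero]

/-- The basis `dz_1, …, dz_n` of the module of differentials. -/
noncomputable def diffBasis : Module.Basis (Fin n) (PolyRing k V) (Ω[PolyRing k V⁄k]) :=
  Module.Basis.mk (v := fun i => KaehlerDifferential.D k (PolyRing k V) (localCoord b P i))
    (by
      rw [Fintype.linearIndependent_iff]
      intro g hg i
      have := congrArg (partialDeriv b i).liftKaehlerDifferential hg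
      simpa [Derivation.liftKaehlerDifferential_comp_D, partialDeriv_localCoord] using this)
    (by
      set N := Submodule.span (PolyRing k V)
        (Set.range fun i => KaehlerDifferential.D k (PolyRing k V) (localCoord b P i))
      have h0 : N.mkQ.compDer (KaehlerDifferential.D k (PolyRing k V)) = 0 := by
        apply derivation_ext b P
        intro i
        exact (Submodule.Quotient.mk_eq_zero N).2 (Submodule.subset_span ⟨i, rfl⟩)
      rw [← KaehlerDifferential.span_range_derivation, Submodule.span_le]
      rintro _ ⟨x, rfl⟩
      exact (Submodule.Quotient.mk_eq_zero N).1 (Derivation.congr_fun h0 x))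

theorem diffBasis_apply (i : Fin n) :
    diffBasis b P i = KaehlerDifferential.D k (PolyRing k V) (localCoord b P i) := by
  simp [diffBasis]

/-- The coefficient `f` of a form `f dz_1 ∧ ⋯ ∧ dz_n`. -/
noncomputable def formCoeff : Forms k V n →ₗ[PolyRing k V] PolyRing k V :=
  exteriorPower.alternatingMapLinearEquiv (diffBasis b P).det

theorem formCoeff_volForm : formCoeff b P (volForm b P) = 1 := by
  have : (fun i => KaehlerDifferential.D k (PolyRing k V) (localCoord b P i)) = diffBasis b P :=
    funext fun i => (diffBasis_apply b P i).symm
  rw [formCoeff, volForm, exteriorPower.alternatingMapLinearEquiv_apply_ιMulti, this,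
    Module.Basis.det_self]

theorem formCoeff_smul_volForm (ω : Forms k V n) : formCoeff b P ω • volForm b P = ω := by
  have : (LinearMap.toSpanSingleton _ _ (volForm b P)) ∘ₗ formCoeff b P = LinearMap.id := by
    apply exteriorPower.linearMap_ext
    apply (diffBasis b P).ext_alternating
    intro v hv
    let σ : Equiv.Perm (Fin n) := Equiv.ofBijective v (Finite.injective_iff_bijective.1 hv)
    have hσ : (fun i => diffBasis b P (v i)) = diffBasis b P ∘ σ := rfl
    rw [hσ, AlternatingMap.map_perm, AlternatingMap.map_perm]
    congr 1
    have h1 : exteriorPower.ιMulti (PolyRing k V) n (diffBasis b P) = volForm b P :=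
      congrArg _ (funext fun i => diffBasis_apply b P i)
    simp [h1, formCoeff_volForm]
  exact LinearMap.congr_fun this ω

variable (k n) in
/-- Laurent polynomials in `n` variables. -/
abbrev Laurent : Type _ := AddMonoidAlgebra k (Fin n → ℤ)

/-- The expansion of an element of `R` as a polynomial in `z_1, …, z_n`. -/
noncomputable def expand : PolyRing k V →ₐ[k] Laurent k n :=
  SymmetricAlgebra.lift <|
    (∑ i, (LinearMap.toSpanSingleton k (Laurent k n)
      (AddMonoidAlgebra.single (Pi.single i 1) 1)) ∘ₗ Module.Dual.eval k V (b i)) +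
    (LinearMap.toSpanSingleton k (Laurent k n) 1) ∘ₗ Module.Dual.eval k V P

theorem expand_ι (f : Module.Dual k V) : expand b P (SymmetricAlgebra.ι k _ f) =
    (∑ i, f (b i) • (AddMonoidAlgebra.single (Pi.single i 1) 1)) + f P • 1 := by
  simp [expand]

theorem expand_localCoord (i : Fin n) :
    expand b P (localCoord b P i) = AddMonoidAlgebra.single (Pi.single i 1) 1 := by
  rw [localCoord, map_sub, expand_ι, AlgHom.commutes, Algebra.algebraMap_eq_smul_one]
  simp [Finsupp.single_apply]


theorem prod_single (s : Finset (Fin n)) (f : Fin n → Fin n → ℤ) :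
    ∏ i ∈ s, (AddMonoidAlgebra.single (f i) 1 : Laurent k n) =
      AddMonoidAlgebra.single (∑ i ∈ s, f i) 1 := by
  induction s using Finset.cons_induction with
  | empty => simp [AddMonoidAlgebra.one_def]
  | cons i s hi ih => rw [Finset.prod_cons, Finset.sum_cons, ih,
      AddMonoidAlgebra.single_mul_single, one_mul]

theorem expand_denom (a : Fin n →₀ ℕ) :
    expand b P (denom b P a) = AddMonoidAlgebra.single (fun i => (a i : ℤ) + 1) 1 := by
  have h1 : ((denom b P a : cechMonoid (localCoord b P) Set.univ) : PolyRing k V) =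
      ∏ i, localCoord b P i ^ (a i + 1) := by
    simp [denom]
  rw [h1, map_prod]
  simp only [map_pow, expand_localCoord, AddMonoidAlgebra.single_pow, one_pow]
  rw [prod_single]
  congr 1
  ext j
  simp [Pi.single_apply]

theorem exists_expand_eq_single (J : Set (Fin n)) (s : cechMonoid (localCoord b P) J) :
    ∃ e : Fin n → ℤ, (∀ i ∉ J, e i = 0) ∧ expand b P s = AddMonoidAlgebra.single e 1 := by
  obtain ⟨s, hs⟩ := s
  induction hs using Submonoid.closure_induction with
  | mem x hx =>
    obtain ⟨j, hj, rfl⟩ := hx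
    refine ⟨Pi.single j 1, fun i hi => ?_, expand_localCoord b P j⟩
    rw [Pi.single_apply, if_neg]
    rintro rfl
    exact hi hj
  | one => exact ⟨0, fun _ _ => rfl, by simp [AddMonoidAlgebra.one_def]⟩
  | mul x y _ _ hx hy =>
    obtain ⟨e, he, he'⟩ := hx
    obtain ⟨f, hf, hf'⟩ := hy
    refine ⟨e + f, fun i hi => by simp [he i hi, hf i hi], ?_⟩
    simp only [map_mul] at he' hf' ⊢
    rw [he', hf', AddMonoidAlgebra.single_mul_single, one_mul]

/-- Laurent polynomials in `n` variables, as a module over `R` by expansion in the `z_i`. -/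
def LaurentAt (_ : Module.Basis (Fin n) k V) (_ : V) : Type _ := Laurent k n

noncomputable instance : CommRing (LaurentAt b P) := inferInstanceAs (CommRing (Laurent k n))

noncomputable instance : Algebra (PolyRing k V) (LaurentAt b P) :=
  (expand b P).toRingHom.toAlgebra

/-- The identification of `LaurentAt b P` with the ring of Laurent polynomials. -/
noncomputable def LaurentAt.equiv : LaurentAt b P ≃+* Laurent k n := RingEquiv.refl _

theorem LaurentAt.equiv_algebraMap (r : PolyRing k V) :
    LaurentAt.equiv b P (algebraMap _ _ r) = expand b P r := rfl

theorem isUnit_laurentAt (i : Fin n) : IsUnit (algebraMap (PolyRing k V)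
    (Module.End (PolyRing k V) (LaurentAt b P)) (localCoord b P i)) := by
  have h : IsUnit (algebraMap (PolyRing k V) (LaurentAt b P) (localCoord b P i)) := by
    rw [← isUnit_map_iff (LaurentAt.equiv b P), LaurentAt.equiv_algebraMap, expand_localCoord]
    refine IsUnit.of_mul_eq_one (AddMonoidAlgebra.single (-Pi.single i 1) 1) ?_
    rw [AddMonoidAlgebra.single_mul_single]
    simp [AddMonoidAlgebra.one_def]
  have h2 : algebraMap (PolyRing k V)
    (Module.End (PolyRing k V) (LaurentAt b P)) (localCoord b P i) =
      Algebra.lmul (PolyRing k V) (LaurentAt b P) (algebraMap _ _ (localCoord b P i)) := by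
    ext x
    simp [Algebra.smul_def]
  rw [h2]
  exact h.map _

/-- The coefficient of a meromorphic form, expanded as a Laurent polynomial in the `z_i`:
`(f dz_1 ∧ ⋯ ∧ dz_n) / s ↦ f / s`. -/
noncomputable def laurentCoeff :
    LocalizedModule (cechMonoid (localCoord b P) Set.univ) (Forms k V n) →ₗ[PolyRing k V]
      LaurentAt b P :=
  LocalizedModule.lift _ (Algebra.linearMap (PolyRing k V) (LaurentAt b P) ∘ₗ formCoeff b P)
    (isUnit_of_cechMonoid _ _ fun i _ => isUnit_laurentAt b P i)

/-- Auxiliary name for the value of `laurentCoeff` as a Laurent polynomial. -/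
noncomputable def laurent
    (x : LocalizedModule (cechMonoid (localCoord b P) Set.univ) (Forms k V n)) : Laurent k n :=
  LaurentAt.equiv b P (laurentCoeff b P x)

theorem laurent_add (x y) : laurent b P (x + y) = laurent b P x + laurent b P y := by
  simp [laurent]

theorem laurent_smul (r : PolyRing k V) (x) :
    laurent b P (r • x) = expand b P r * laurent b P x := by
  rw [laurent, map_smul, Algebra.smul_def, map_mul, LaurentAt.equiv_algebraMap, laurent]

theorem laurent_mk_one (ω : Forms k V n) :
    laurent b P (LocalizedModule.mk ω 1) = expand b P (formCoeff b P ω) := by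
  rw [laurent, laurentCoeff, LocalizedModule.lift_mk_one]
  rfl

theorem laurent_of_smul (x) (s ω) (e : Fin n → ℤ)
    (hs : expand b P s = AddMonoidAlgebra.single e 1) (hx : s • x = LocalizedModule.mk ω 1) :
    laurent b P x = AddMonoidAlgebra.single (-e) 1 * expand b P (formCoeff b P ω) := by
  rw [← laurent_mk_one, ← hx, laurent_smul, hs, ← mul_assoc, AddMonoidAlgebra.single_mul_single]
  rw [neg_add_cancel, one_mul, ← AddMonoidAlgebra.one_def, one_mul]

theorem laurent_genFrac (r : PolyRing k V) (a : Fin n →₀ ℕ) :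
    laurent b P (LocalizedModule.mk (r • volForm b P) (denom b P a)) =
      AddMonoidAlgebra.single (-fun i => (a i : ℤ) + 1) 1 * expand b P r := by
  have := laurent_of_smul b P (LocalizedModule.mk (r • volForm b P) (denom b P a))
    (denom b P a) (r • volForm b P) _ (expand_denom b P a) (by
      rw [LocalizedModule.smul'_mk]
      exact LocalizedModule.mk_cancel (denom b P a) (r • volForm b P))
  rw [this, map_smul, formCoeff_volForm, smul_eq_mul, mul_one]

theorem expand_coeff_of_neg (r : PolyRing k V) (d : Fin n → ℤ) (i : Fin n) (hd : d i < 0) :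
    (expand b P r).coeff d = 0 := by
  let N : Subalgebra k (Laurent k n) :=
    { carrier := {x | ∀ d ∈ x.coeff.support, 0 ≤ d i}
      mul_mem' := by
        classical
        intro x y hx hy d hd
        obtain ⟨u, hu, v, hv, rfl⟩ := Finset.mem_add.1 (AddMonoidAlgebra.support_coeff_mul_subset _ _ hd)
        exact add_nonneg (hx u hu) (hy v hv)
      add_mem' := by
        classical
        intro x y hx hy d hd
        rcases Finset.mem_union.1 (Finsupp.support_add hd) with h | h
        · exact hx d h
        · exact hy d h
      algebraMap_mem' := by
        intro c d hd
        rw [Algebra.algebraMap_eq_smul_one, AddMonoidAlgebra.one_def] at hd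
        have := Finsupp.support_single_subset (Finsupp.support_smul hd)
        rw [Finset.mem_singleton.1 this]
        rfl }
  have hN : expand b P r ∈ N := by
    induction r using SymmetricAlgebra.induction with
    | algebraMap c => rw [AlgHom.commutes]; exact N.algebraMap_mem c
    | ι f =>
      rw [expand_ι]
      refine N.add_mem (N.sum_mem fun j _ => N.smul_mem ?_ _) (N.smul_mem N.one_mem _)
      intro d hd
      have := Finsupp.support_single_subset hd
      rw [Finset.mem_singleton.1 this, Pi.single_apply]
      split_ifs <;> simp
    | mul x y hx hy => rw [map_mul]; exact N.mul_mem hx hy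
    | add x y hx hy => rw [map_add]; exact N.add_mem hx hy
  by_contra h
  exact absurd (hN d (Finsupp.mem_support_iff.2 h)) (not_le.2 hd)


theorem laurent_cechFace_coeff (i : Fin n) (x) (d : Fin n → ℤ) (hd : d i < 0) :
    (laurent b P (cechFace (localCoord b P) (Forms k V n) i x)).coeff d = 0 := by
  induction x using LocalizedModule.induction_on with
  | h ω s =>
    obtain ⟨e, he, hs⟩ := exists_expand_eq_single b P {i}ᶜ s
    have h1 : (s : PolyRing k V) • cechFace (localCoord b P) (Forms k V n) i
        (LocalizedModule.mk ω s) = LocalizedModule.mk ω 1 := by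
      rw [← map_smul, LocalizedModule.smul'_mk]
      have : LocalizedModule.mk ((s : PolyRing k V) • ω) s = LocalizedModule.mk ω 1 :=
        LocalizedModule.mk_cancel s ω
      rw [this, cechFace, LocalizedModule.lift_mk_one]
      rfl
    rw [laurent_of_smul b P _ _ _ e hs h1, AddMonoidAlgebra.coeff_single_mul_apply, one_mul]
    apply expand_coeff_of_neg b P _ _ i
    simpa [he i (by simp)] using hd

/-- The coefficient of `(z_1 ⋯ z_n)⁻¹` in the Laurent expansion of a meromorphic form. -/
noncomputable def resAux :
    LocalizedModule (cechMonoid (localCoord b P) Set.univ) (Forms k V n) →+ k where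
  toFun x := (laurent b P x).coeff (fun _ => -1)
  map_zero' := by rw [laurent, LinearMap.map_zero, map_zero]; rfl
  map_add' x y := by rw [laurent_add]; rfl

theorem resAux_eq_zero (x) (hx : x ∈ cechBoundary (localCoord b P) (Forms k V n)) :
    resAux b P x = 0 := by
  refine Submodule.iSup_induction _ (motive := fun x => resAux b P x = 0) hx ?_ ?_ ?_
  · rintro i _ ⟨y, rfl⟩
    exact laurent_cechFace_coeff b P i y _ (by simp)
  · exact AddMonoidHom.map_zero _
  · intro x y hx hy
    rw [AddMonoidHom.map_add, hx, hy, add_zero]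

/-- The residue as an additive map. -/
noncomputable def resAdd : CechTop (localCoord b P) (Forms k V n) →+ k :=
  QuotientAddGroup.lift (cechBoundary (localCoord b P) (Forms k V n)).toAddSubgroup
    (resAux b P) (fun x hx => resAux_eq_zero b P x hx)

/-- The residue `Res_P : H^n_{𝔪_P}(R, Ω^n) → k`: the coefficient of `(z_1 ⋯ z_n)⁻¹` in the Laurent
expansion of a meromorphic form. -/
noncomputable def res : LC b P →ₗ[k] k where
  toFun := resAdd b P
  map_add' := map_add (resAdd b P)
  map_smul' := by
    intro c η
    obtain ⟨ω, s, rfl⟩ := LC.mk_surjective b P η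
    rw [← LC.algebraMap_smul, LC.smul_mk]
    change (laurent b P (LocalizedModule.mk (algebraMap k (PolyRing k V) c • ω) s)).coeff _ =
      c • (laurent b P (LocalizedModule.mk ω s)).coeff _
    rw [← LocalizedModule.smul'_mk, laurent_smul, AlgHom.commutes, ← Algebra.smul_def]
    rfl

theorem res_mk (ω : Forms k V n) (s) : res b P (LC.mk b P ω s) =
    (laurent b P (LocalizedModule.mk ω s)).coeff (fun _ => -1) := rfl

theorem res_smul_genFrac (r : PolyRing k V) (a : Fin n →₀ ℕ) :
    res b P (r • genFrac b P a) = (expand b P r).coeff (fun i => (a i : ℤ)) := by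
  rw [genFrac, LC.smul_mk, res_mk, laurent_genFrac, AddMonoidAlgebra.coeff_single_mul_apply, one_mul]
  congr 1
  ext i
  simp

/-- The monomial `∏ z_i ^ a_i`. -/
noncomputable def localMonomial (a : Fin n →₀ ℕ) : PolyRing k V :=
  ∏ i, localCoord b P i ^ a i

theorem expand_localMonomial (a : Fin n →₀ ℕ) :
    expand b P (localMonomial b P a) = AddMonoidAlgebra.single (fun i => (a i : ℤ)) 1 := by
  rw [localMonomial, map_prod]
  simp only [map_pow, expand_localCoord, AddMonoidAlgebra.single_pow, one_pow]
  rw [prod_single]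
  congr 1
  ext j
  simp [Pi.single_apply]

theorem res_localMonomial_smul_genFrac (a c : Fin n →₀ ℕ) :
    res b P (localMonomial b P a • genFrac b P c) = if a = c then 1 else 0 := by
  rw [res_smul_genFrac, expand_localMonomial, AddMonoidAlgebra.coeff_single, Finsupp.single_apply]
  simp [funext_iff, DFunLike.ext_iff]

theorem linearIndependent_genFrac : LinearIndependent k (genFrac b P) := by
  rw [linearIndependent_iff]
  intro l hl
  ext a
  have h := congrArg (fun η => res b P (localMonomial b P a • η)) hl
  simp only [Finsupp.linearCombination_apply, Finsupp.sum, Finset.smul_sum, map_sum,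
    smul_comm (localMonomial b P a) (_ : k), map_smul, res_localMonomial_smul_genFrac,
    smul_zero, map_zero] at h
  simpa using h

theorem denom_mem (i : Fin n) (a : Fin n →₀ ℕ) :
    ∏ j ∈ Finset.univ.erase i, localCoord b P j ^ (a j + 1) ∈
      cechMonoid (localCoord b P) {i}ᶜ :=
  Submonoid.prod_mem _ fun j hj => Submonoid.pow_mem _
    (Submonoid.subset_closure (Set.mem_image_of_mem _ (by
      simpa using (Finset.mem_erase.1 hj).1))) _

theorem coe_denom (a : Fin n →₀ ℕ) :
    ((denom b P a : cechMonoid (localCoord b P) Set.univ) : PolyRing k V) =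
      ∏ i, localCoord b P i ^ (a i + 1) := by
  simp [denom]

theorem localCoord_smul_genFrac_of_eq_zero (i : Fin n) (a : Fin n →₀ ℕ) (h : a i = 0) :
    localCoord b P i • genFrac b P a = 0 := by
  have hmono : cechMonoid (localCoord b P) {i}ᶜ ≤ cechMonoid (localCoord b P) Set.univ :=
    Submonoid.closure_mono (Set.image_mono (Set.subset_univ _))
  let s : cechMonoid (localCoord b P) Set.univ :=
    ⟨∏ j ∈ Finset.univ.erase i, localCoord b P j ^ (a j + 1), hmono (denom_mem b P i a)⟩
  let t : cechMonoid (localCoord b P) Set.univ :=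
    ⟨localCoord b P i, Submonoid.subset_closure (Set.mem_image_of_mem _ (Set.mem_univ i))⟩
  have hts : denom b P a = t * s := by
    apply Subtype.ext
    rw [coe_denom, ← Finset.mul_prod_erase _ _ (Finset.mem_univ i), h, zero_add, pow_one]
    rfl
  rw [genFrac, LC.smul_mk, hts]
  exact (LC.mk_cancel b P t s _).trans (LC.mk_eq_zero b P i _ s (denom_mem b P i a))

theorem localCoord_smul_genFrac (i : Fin n) (a : Fin n →₀ ℕ) :
    localCoord b P i • genFrac b P (a + Finsupp.single i 1) = genFrac b P a := by
  let t : cechMonoid (localCoord b P) Set.univ :=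
    ⟨localCoord b P i, Submonoid.subset_closure (Set.mem_image_of_mem _ (Set.mem_univ i))⟩
  have hts : denom b P (a + Finsupp.single i 1) = t * denom b P a := by
    apply Subtype.ext
    rw [Submonoid.coe_mul, coe_denom, coe_denom, ← Finset.mul_prod_erase _ _ (Finset.mem_univ i),
      ← Finset.mul_prod_erase _ (fun i => localCoord b P i ^ (a i + 1)) (Finset.mem_univ i),
      ← mul_assoc]
    congr 1
    · simp only [Finsupp.add_apply, Finsupp.single_eq_same, t]
      ring
    · refine Finset.prod_congr rfl fun j hj => ?_
      simp [(Finset.mem_erase.1 hj).1.symm]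
  rw [genFrac, LC.smul_mk, hts]
  exact LC.mk_cancel b P t _ _

theorem exists_mul_eq_denom (s : cechMonoid (localCoord b P) Set.univ) :
    ∃ t a, t * s = denom b P a := by
  obtain ⟨s, hs⟩ := s
  have : ∃ e : Fin n → ℕ, s = ∏ i, localCoord b P i ^ e i := by
    induction hs using Submonoid.closure_induction with
    | mem x hx =>
      obtain ⟨j, -, rfl⟩ := hx
      refine ⟨Pi.single j 1, ?_⟩
      simp [Pi.single_apply, Finset.prod_ite_eq', pow_ite]
    | one => exact ⟨0, by simp⟩
    | mul x y _ _ hx hy =>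
      obtain ⟨e, rfl⟩ := hx
      obtain ⟨f, rfl⟩ := hy
      exact ⟨e + f, by simp [pow_add, Finset.prod_mul_distrib]⟩
  obtain ⟨e, rfl⟩ := this
  refine ⟨⟨∏ i, localCoord b P i, Submonoid.prod_mem _ fun i _ =>
    Submonoid.subset_closure ⟨i, trivial, rfl⟩⟩, Finsupp.equivFunOnFinite.symm e, ?_⟩
  apply Subtype.ext
  rw [Submonoid.coe_mul, coe_denom, ← Finset.prod_mul_distrib]
  simp [pow_succ, mul_comm]

theorem span_genFrac : Submodule.span k (Set.range (genFrac b P)) = ⊤ := by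
  set N := Submodule.span k (Set.range (genFrac b P)) with hN
  have hz : ∀ i, ∀ η ∈ N, localCoord b P i • η ∈ N := by
    intro i η hη
    induction hη using Submodule.span_induction with
    | mem x hx =>
      obtain ⟨a, rfl⟩ := hx
      by_cases h : a i = 0
      · rw [localCoord_smul_genFrac_of_eq_zero b P i a h]; exact N.zero_mem
      · obtain ⟨c, rfl⟩ : ∃ c, a = c + Finsupp.single i 1 := by
          refine ⟨a - Finsupp.single i 1, (tsub_add_cancel_of_le ?_).symm⟩
          simpa [Nat.one_le_iff_ne_zero] using h
        rw [localCoord_smul_genFrac]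
        exact Submodule.subset_span ⟨c, rfl⟩
    | zero => rw [smul_zero]; exact N.zero_mem
    | add x y _ _ hx hy => rw [smul_add]; exact N.add_mem hx hy
    | smul c x _ hx => rw [smul_comm]; exact N.smul_mem c hx
  have hr : ∀ (r : PolyRing k V), ∀ η ∈ N, r • η ∈ N := by
    intro r
    induction r using SymmetricAlgebra.induction with
    | algebraMap c => intro η hη; exact N.smul_mem c hη
    | ι f =>
      intro η hη
      have hf : f = ∑ i, f (b i) • b.coord i := by
        refine b.ext fun j => ?_
        simp
      rw [hf, map_sum, Finset.sum_smul]
      refine N.sum_mem fun i _ => ?_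
      have : SymmetricAlgebra.ι k (Module.Dual k V) (b.coord i) =
        localCoord b P i + algebraMap k (PolyRing k V) (b.coord i P) := by simp [localCoord]
      rw [map_smul, smul_assoc, this, add_smul]
      exact N.smul_mem _ (N.add_mem (hz i η hη) (N.smul_mem _ hη))
    | mul x y hx hy => intro η hη; rw [mul_smul]; exact hx _ (hy _ hη)
    | add x y hx hy => intro η hη; rw [add_smul]; exact N.add_mem (hx _ hη) (hy _ hη)
  rw [eq_top_iff]
  rintro η -
  obtain ⟨ω, s, rfl⟩ := LC.mk_surjective b P η
  obtain ⟨t, a, h⟩ := exists_mul_eq_denom b P s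
  rw [← LC.mk_cancel b P t s ω, h, ← formCoeff_smul_volForm b P ω, ← LC.smul_mk, ← LC.smul_mk]
  exact hr _ _ (hr _ _ (Submodule.subset_span ⟨a, rfl⟩))

/-- The generalised fractions form a `k`-basis of the local cohomology module. -/
noncomputable def LC.basis : Module.Basis (Fin n →₀ ℕ) k (LC b P) :=
  Module.Basis.mk (linearIndependent_genFrac b P) (span_genFrac b P).ge

theorem LC.basis_apply (a : Fin n →₀ ℕ) : LC.basis b P a = genFrac b P a := by
  simp [LC.basis]


theorem res_genFrac (a : Fin n →₀ ℕ) : res b P (genFrac b P a) = if a = 0 then 1 else 0 := by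
  have h := res_localMonomial_smul_genFrac b P 0 a
  have h1 : localMonomial b P 0 = 1 := by simp [localMonomial]
  rw [h1, one_smul] at h
  rw [h]
  simp [eq_comm]

/-- The coalgebra structure of `H^n_{𝔪_P}(R, Ω^n)`. The counit is the residue. On the generalised
fractions `F_a = [dz_1 ∧ ⋯ ∧ dz_n / z_1^{a_1+1}, …, z_n^{a_n+1}]` the coproduct is
`Δ F_a = ∑_{c + d = a} F_c ⊗ F_d`. In terms of the states `|ν_1, …, ν_s⟩` with `e_i` occurring `a_i`
times among the `ν_t`, which are `a_1! ⋯ a_n! F_a`, this is the sum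
`Δ |ν_1, …, ν_s⟩ = ∑_I |ν_I⟩ ⊗ |ν_{I^c}⟩` over all subsets `I` of `{1, …, s}`. -/
noncomputable instance : Coalgebra k (LC b P) where
  comul := (LC.basis b P).constr k fun a =>
    ∑ c ∈ Finset.HasAntidiagonal.antidiagonal a, genFrac b P c.1 ⊗ₜ[k] genFrac b P c.2
  counit := res b P
  coassoc := by
    refine (LC.basis b P).ext fun a => ?_
    simp only [LinearMap.comp_apply, Module.Basis.constr_basis, map_sum, LinearMap.rTensor_tmul,
      LinearMap.lTensor_tmul, ← LC.basis_apply, LinearEquiv.coe_coe, TensorProduct.sum_tmul,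
      TensorProduct.tmul_sum, TensorProduct.assoc_tmul, Finset.sum_sigma']
    refine Finset.sum_nbij' (fun ⟨⟨_i, j⟩, ⟨k, l⟩⟩ ↦ ⟨(k, l + j), (l, j)⟩)
      (fun ⟨⟨i, _j⟩, ⟨k, l⟩⟩ ↦ ⟨(i + k, l), (i, k)⟩) ?_ ?_ ?_ ?_ ?_
    · rintro ⟨⟨i, j⟩, ⟨p, q⟩⟩ h
      simp only [Finset.mem_sigma, Finset.HasAntidiagonal.mem_antidiagonal] at h ⊢
      exact ⟨by rw [← h.1, ← h.2, add_assoc], trivial⟩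
    · rintro ⟨⟨i, j⟩, ⟨p, q⟩⟩ h
      simp only [Finset.mem_sigma, Finset.HasAntidiagonal.mem_antidiagonal] at h ⊢
      exact ⟨by rw [← h.1, ← h.2, add_assoc], trivial⟩
    · rintro ⟨⟨i, j⟩, ⟨p, q⟩⟩ h
      simp only [Finset.mem_sigma, Finset.HasAntidiagonal.mem_antidiagonal] at h
      obtain ⟨-, rfl⟩ := h
      rfl
    · rintro ⟨⟨i, j⟩, ⟨p, q⟩⟩ h
      simp only [Finset.mem_sigma, Finset.HasAntidiagonal.mem_antidiagonal] at h
      obtain ⟨-, rfl⟩ := h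
      rfl
    · rintro ⟨⟨i, j⟩, ⟨p, q⟩⟩ h
      rfl
  rTensor_counit_comp_comul := by
    refine (LC.basis b P).ext fun a => ?_
    simp only [LinearMap.comp_apply, Module.Basis.constr_basis, map_sum, LinearMap.rTensor_tmul,
      res_genFrac, TensorProduct.mk_apply]
    rw [Finset.sum_eq_single (0, a)]
    · simp [LC.basis_apply]
    · rintro ⟨p, q⟩ h hne
      rw [if_neg, TensorProduct.zero_tmul]
      rintro rfl
      rw [Finset.HasAntidiagonal.mem_antidiagonal] at h
      exact hne (by simp [← h])
    · intro h
      exact absurd (Finset.HasAntidiagonal.mem_antidiagonal.2 (zero_add a)) h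
  lTensor_counit_comp_comul := by
    refine (LC.basis b P).ext fun a => ?_
    simp only [LinearMap.comp_apply, Module.Basis.constr_basis, map_sum, LinearMap.lTensor_tmul,
      res_genFrac, LinearMap.flip_apply, TensorProduct.mk_apply]
    rw [Finset.sum_eq_single (a, 0)]
    · simp [LC.basis_apply]
    · rintro ⟨p, q⟩ h hne
      rw [if_neg, TensorProduct.tmul_zero]
      rintro rfl
      rw [Finset.HasAntidiagonal.mem_antidiagonal] at h
      exact hne (by simp [← h])
    · intro h
      exact absurd (Finset.HasAntidiagonal.mem_antidiagonal.2 (add_zero a)) h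

theorem LC.comul_genFrac (a : Fin n →₀ ℕ) :
    Coalgebra.comul (R := k) (genFrac b P a) =
      ∑ c ∈ Finset.HasAntidiagonal.antidiagonal a, genFrac b P c.1 ⊗ₜ[k] genFrac b P c.2 := by
  rw [← LC.basis_apply]
  exact (LC.basis b P).constr_basis k _ a

/-- The coalgebra `!V = ⨁_P H^n_{𝔪_P}(R, Ω^n)`, with the coproduct and counit of a direct sum of
coalgebras. -/
abbrev Bang (b : Module.Basis (Fin n) k V) : Type _ := Π₀ P : V, LC b P

/-- The sum of the residue maps, `Res = ∑_P Res_P : !V → k`. -/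
noncomputable def totalRes [DecidableEq V] : Bang b →ₗ[k] k := DFinsupp.lsum k (res b)

end Residue
end CofreeCoalgebra

/-! A functional that vanishes on an ideal `I` of finite codimension lives on the Artinian ring `S ⧸
I`, which is the product of its local factors. Splitting `1` into the corresponding idempotents
writes the functional as a finite sum of functionals that each kill a power `m ^ N` of one maximal
ideal (`ContDual.induction_primary`). This holds for any commutative `k`-algebra and gives
surjectivity in both halves of the theorem.

For the decomposition over maximal ideals, a functional killing `m ^ N` extends to the localization
because elements outside `m` are already invertible modulo `m ^ N` (`exists_restrictCont_eq`). In
the other direction, a continuous functional on the localization kills a power of the maximal ideal,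
modulo which every fraction comes from `S`, so restriction is injective on each summand. Different
summands are independent because powers of distinct maximal ideals are coprime: an element congruent
to `1` modulo one power and lying in the others isolates one component.

For residues, the heart is the duality `Res_P(z^a F_c) = δ_{ac}`: the classes `F_c` are the dual
family to the monomials `z^a`, so `H_P` is exactly the space of functionals killing some power of
`𝔪_P` (`resPairing_injective`, `exists_resPairing_eq`). Under this duality the coproduct of `F_a` is
the transpose of `z^u z^v = z^{u+v}` (`map_resPairing_comul`). Since `k` is algebraically closed, a
maximal ideal with finite residue field belongs to a point `P`, so the sum over points reaches every
primary piece, and the same coprimality argument shows that the sum is direct. -/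

/-! ### Coprime ideals and powers of maximal ideals -/

/-- Chinese remainder theorem. Multiplying by `e` isolates the component at `i` in a finite sum,
which is how independence of summands is proved below. -/
theorem Ideal.exists_sub_one_mem_and_mem_of_coprime {S ι : Type*} [CommRing S] {I : ι → Ideal S}
    (hI : Pairwise (Function.onFun IsCoprime I)) (s : Finset ι) (i : ι) :
    ∃ e : S, e - 1 ∈ I i ∧ ∀ j ∈ s, j ≠ i → e ∈ I j := by
  classical
  -- Indexing by `insert i s` imposes the congruence at `i` even when `i ∉ s`.
  obtain ⟨e, he⟩ := Ideal.exists_forall_sub_mem_ideal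
    (I := fun j : ↥(insert i s) => I j) (fun j l h => hI (fun h' => h (Subtype.ext h')))
    (fun j => if (j : ι) = i then 1 else 0)
  refine ⟨e, by simpa using he ⟨i, by simp⟩, fun j hj hji => ?_⟩
  simpa [hji] using he ⟨j, by simp [hj]⟩

/-- By maximality `(y)` is coprime to `m`, and coprimality passes to powers. Hence `d` is an inverse
of `y` modulo `m ^ N`. -/
theorem Ideal.IsMaximal.exists_mul_add_eq_one_of_notMem {S : Type*} [CommRing S] (m : Ideal S)
    [hm : m.IsMaximal] (N : ℕ) {y : S} (hy : y ∉ m) : ∃ d, ∃ c ∈ m ^ N, d * y + c = 1 := by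
  obtain ⟨d, i, hi, h⟩ := hm.exists_inv hy
  have hcop : IsCoprime (Ideal.span {y}) (m ^ N) := IsCoprime.pow_right
    (Ideal.isCoprime_iff_exists.2 ⟨d * y, Ideal.mem_span_singleton'.2 ⟨d, rfl⟩, i, hi, h⟩)
  obtain ⟨a, ha, c, hc, h⟩ := Ideal.isCoprime_iff_exists.1 hcop
  obtain ⟨d, rfl⟩ := Ideal.mem_span_singleton'.1 ha
  exact ⟨d, c, hc, h⟩

/-- An ideal of finite codimension in a local algebra contains a power of the
maximal ideal. -/
theorem IsLocalRing.exists_maximalIdeal_pow_le {k T : Type*} [Field k] [CommRing T] [Algebra k T]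
    [IsLocalRing T] (J : Ideal T) [FiniteDimensional k (T ⧸ J)] :
    ∃ N : ℕ, IsLocalRing.maximalIdeal T ^ N ≤ J := by
  have : IsArtinianRing (T ⧸ J) := IsArtinianRing.of_finite k (T ⧸ J)
  obtain ⟨N, hN⟩ := IsArtinianRing.isNilpotent_jacobson_bot (R := T ⧸ J)
  refine ⟨N, ?_⟩
  -- The Jacobson radical of the Artinian ring `T ⧸ J` is nilpotent, and its preimage is the
  -- Jacobson radical of `J`. The argument also covers `J = ⊤`.
  have hle : (IsLocalRing.maximalIdeal T).map (Ideal.Quotient.mk J) ≤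
      Ideal.jacobson (⊥ : Ideal (T ⧸ J)) := by
    rw [Ideal.map_le_iff_le_comap,
      Ideal.comap_jacobson_of_surjective Ideal.Quotient.mk_surjective]
    exact (IsLocalRing.maximalIdeal_le_jacobson _)
  intro x hx
  have h := Ideal.pow_right_mono hle N (Ideal.map_pow (Ideal.Quotient.mk J) _ N ▸
    Ideal.mem_map_of_mem (Ideal.Quotient.mk J) hx)
  rw [hN] at h
  exact Ideal.Quotient.eq_zero_iff_mem.1 h

/-! ### Continuous functionals and localization at maximal ideals -/

namespace CofreeCoalgebra

section ContinuousDual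

variable {k S : Type*} [Field k] [CommRing S] [Algebra k S]

theorem ContDual.ext {μ ν : ContDual k S} (h : ∀ x, μ x = ν x) : μ = ν :=
  ContDual.incl_injective (LinearMap.ext h)

theorem ContDual.smul_apply' (a : S) (μ : ContDual k S) (x : S) : (a • μ) x = μ (a * x) := rfl

theorem ContDual.exists_ideal (μ : ContDual k S) :
    ∃ I : Ideal S, FiniteDimensional k (S ⧸ I) ∧ ∀ x ∈ I, μ x = 0 := μ.2

/-- Every continuous functional is a finite sum of functionals vanishing on a power of a maximal
ideal with finite residue field. -/
theorem ContDual.induction_primary {motive : ContDual k S → Prop} (zero : motive 0)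
    (add : ∀ μ ν, motive μ → motive ν → motive (μ + ν))
    (primary : ∀ (μ : ContDual k S) (m : Ideal S) (N : ℕ), m.IsMaximal →
      FiniteDimensional k (S ⧸ m) → (∀ x ∈ m ^ N, μ x = 0) → motive μ)
    (μ : ContDual k S) : motive μ := by
  classical
  obtain ⟨I, hI, hμ⟩ := μ.exists_ideal
  have : IsArtinianRing (S ⧸ I) := IsArtinianRing.of_finite k (S ⧸ I)
  obtain ⟨N, hN⟩ := IsArtinianRing.isNilpotent_nilradical (R := S ⧸ I)
  rw [IsArtinianRing.nilradical_pow_eq_iInf] at hN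
  -- The `N`-th power of the nilradical is zero and equals the intersection of the `m ^ N`, so
  -- identities in `S ⧸ I` can be tested modulo each `m ^ N`.
  have hzero : ∀ x : S ⧸ I, (∀ m : MaximalSpectrum (S ⧸ I), x ∈ m.asIdeal ^ N) → x = 0 :=
    fun x hx => by simpa [hN] using (Submodule.mem_iInf (fun m : MaximalSpectrum (S ⧸ I) =>
      m.asIdeal ^ N)).2 hx
  have hcop : Pairwise (Function.onFun IsCoprime
      fun m : MaximalSpectrum (S ⧸ I) => m.asIdeal ^ N) :=
    fun m m' h => (MaximalSpectrum.isCoprime_of_ne h).pow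
  let _ := Fintype.ofFinite (MaximalSpectrum (S ⧸ I))
  -- The `e m` are the idempotents of the product decomposition of `S ⧸ I`. Their lifts `f m` sum to
  -- `1` only modulo `I`, which suffices because `μ` kills `I`.
  choose e he1 he0 using fun m : MaximalSpectrum (S ⧸ I) =>
    Ideal.exists_sub_one_mem_and_mem_of_coprime hcop Finset.univ m
  choose f hf using fun m => Ideal.Quotient.mk_surjective (I := I) (e m)
  have hsum : ∑ m, e m = 1 := by
    rw [← sub_eq_zero]
    refine hzero _ fun m => ?_
    rw [← Finset.add_sum_erase _ _ (Finset.mem_univ m), add_sub_right_comm]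
    exact add_mem (he1 m) (sum_mem fun m' hm' =>
      he0 m' m (Finset.mem_univ _) (Finset.ne_of_mem_erase hm').symm)
  have hμ' : μ = ∑ m, f m • μ := by
    rw [← Finset.sum_smul]
    refine ContDual.ext fun x => ?_
    rw [ContDual.smul_apply', ← sub_eq_zero, ← map_sub]
    apply hμ
    rw [← Ideal.Quotient.eq_zero_iff_mem]
    simp [hf, hsum]
  rw [hμ']
  refine Finset.sum_induction _ motive add zero fun m _ => ?_
  refine primary _ (m.asIdeal.comap (Ideal.Quotient.mk I)) N ?_ ?_ fun x hx => ?_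
  · exact Ideal.comap_isMaximal_of_surjective _ Ideal.Quotient.mk_surjective
  · have hle : I ≤ m.asIdeal.comap (Ideal.Quotient.mk I) := fun x hx => by
      rw [Ideal.mem_comap, Ideal.Quotient.eq_zero_iff_mem.2 hx]; exact zero_mem _
    exact Module.Finite.of_surjective (Ideal.Quotient.factorₐ k hle).toLinearMap
      (Ideal.Quotient.factor_surjective hle)
  · rw [ContDual.smul_apply']
    apply hμ
    rw [← Ideal.Quotient.eq_zero_iff_mem]
    -- At `m` itself the factor `x` supplies membership in the power; at every other maximal ideal
    -- `e m` does.
    refine hzero _ fun m' => ?_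
    rw [map_mul, hf]
    by_cases h : m' = m
    · subst h
      exact Ideal.mul_mem_left _ _ (Ideal.le_comap_pow _ _ hx)
    · exact Ideal.mul_mem_right _ _ (he0 m m' (Finset.mem_univ _) h)

/-- A continuous functional on `S` vanishing on a power of `m` extends to the localization
at `m`. -/
theorem exists_restrictCont_eq (m : Ideal S) [m.IsMaximal] (N : ℕ) (μ : ContDual k S)
    (hμ : ∀ x ∈ m ^ N, μ x = 0) : ∃ ν, restrictCont (k := k) m ν = μ := by
  obtain ⟨I, hI, hIμ⟩ := μ.exists_ideal
  -- `I` makes the quotient by `K` finite-dimensional, `m ^ N` makes everything outside `m`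
  -- invertible in it, and `μ` kills both. The functional on the localization is then the one
  -- induced on `S ⧸ K`, pulled back.
  set K := I ⊔ m ^ N
  have hKμ : ∀ x ∈ K, μ x = 0 := by
    intro x hx
    obtain ⟨y, hy, z, hz, rfl⟩ := Submodule.mem_sup.1 hx
    rw [map_add, hIμ y hy, hμ z hz, add_zero]
  have hfin : FiniteDimensional k (S ⧸ K) :=
    Module.Finite.of_surjective (Ideal.Quotient.factorₐ k (le_sup_left : I ≤ K)).toLinearMap
      (Ideal.Quotient.factor_surjective (le_sup_left : I ≤ K))
  have hunit : ∀ y : m.primeCompl, IsUnit (Ideal.Quotient.mkₐ k K y) := by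
    rintro ⟨y, hy⟩
    obtain ⟨d, c, hc, h⟩ := Ideal.IsMaximal.exists_mul_add_eq_one_of_notMem m N hy
    refine IsUnit.of_mul_eq_one (Ideal.Quotient.mkₐ k K d) ?_
    rw [← map_mul, ← map_one (Ideal.Quotient.mkₐ k K), ← sub_eq_zero, ← map_sub]
    refine Ideal.Quotient.eq_zero_iff_mem.2 ((le_sup_right : m ^ N ≤ K) ?_)
    have : (y : S) * d - 1 = -c := by linear_combination h
    rw [this]
    exact neg_mem hc
  let g : Localization.AtPrime m →ₐ[k] S ⧸ K := IsLocalization.liftAlgHom (M := m.primeCompl) hunit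
  have hg : ∀ x, g (algebraMap S _ x) = Ideal.Quotient.mk K x := fun x =>
    IsLocalization.lift_eq _ _
  let f : Module.Dual k (S ⧸ K) := (Submodule.restrictScalars k K).liftQ (ContDual.incl k S μ) hKμ
  let μ' : ContDual k (S ⧸ K) := ⟨f,
    ⊥, (LinearEquiv.finiteDimensional (AlgEquiv.quotientBot k (S ⧸ K)).symm.toLinearEquiv),
    fun x hx => by rw [(Submodule.mem_bot _).1 hx]; exact LinearMap.map_zero f⟩
  refine ⟨⟨_, comp_mem_contDual g μ'⟩, ContDual.ext fun x => ?_⟩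
  change μ'.1 (g (algebraMap S _ x)) = _
  rw [hg]
  rfl

theorem restrictCont_apply (m : Ideal S) [m.IsPrime] (ν : ContDual k (Localization.AtPrime m))
    (x : S) : restrictCont m ν x = ν (algebraMap S _ x) := rfl

/-- An ideal of finite codimension in the local ring contains a power of the maximal ideal, and `m ^
N` maps into that power. This bound lets coprime powers separate the summands. -/
theorem exists_pow_le_of_contDual_localization (m : Ideal S) [m.IsMaximal]
    (ν : ContDual k (Localization.AtPrime m)) :
    ∃ N : ℕ, ∀ x ∈ m ^ N, restrictCont m ν x = 0 := by
  obtain ⟨J, hJ, hν⟩ := ν.exists_ideal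
  obtain ⟨N, hN⟩ := IsLocalRing.exists_maximalIdeal_pow_le (k := k) J
  refine ⟨N, fun x hx => hν _ (hN ?_)⟩
  rw [← Localization.AtPrime.map_eq_maximalIdeal, ← Ideal.map_pow]
  exact Ideal.mem_map_of_mem _ hx

/-- Modulo a power of the maximal ideal every fraction `x / s` agrees with `x * d`, where `d`
inverts `s` modulo `m ^ N`. So `ν` is determined by its values on the image of `S`. -/
theorem restrictCont_injective (m : Ideal S) [m.IsMaximal] :
    Function.Injective (restrictCont (k := k) m) := by
  rw [injective_iff_map_eq_zero]
  intro ν h0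
  obtain ⟨J, hJ, hν⟩ := ν.exists_ideal
  obtain ⟨N, hN⟩ := IsLocalRing.exists_maximalIdeal_pow_le (k := k) J
  refine ContDual.ext fun y => ?_
  obtain ⟨⟨x, s⟩, hxs⟩ := IsLocalization.surj m.primeCompl y
  obtain ⟨d, c, hc, h⟩ := Ideal.IsMaximal.exists_mul_add_eq_one_of_notMem m N s.2
  have hy : y = algebraMap S _ (x * d) + algebraMap S _ c * y := by
    rw [map_mul, ← hxs]
    have := congrArg (algebraMap S (Localization.AtPrime m)) h
    rw [map_add, map_mul, map_one] at this
    linear_combination (-y) * this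
  have hc' : algebraMap S (Localization.AtPrime m) c ∈ J := hN (by
    rw [← Localization.AtPrime.map_eq_maximalIdeal, ← Ideal.map_pow]
    exact Ideal.mem_map_of_mem _ hc)
  rw [hy, map_add, hν _ (J.mul_mem_right _ hc'), add_zero, ← restrictCont_apply, h0]
  rfl

theorem decompMap_of [DecidableEq (MaximalSpectrum S)] (m : MaximalSpectrum S)
    (ν : ContDual k (Localization.AtPrime m.asIdeal)) :
    decompMap k S (DirectSum.of
      (fun m : MaximalSpectrum S => ContDual k (Localization.AtPrime m.asIdeal)) m ν) =
      restrictCont m.asIdeal ν :=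
  DFinsupp.sumAddHom_single
    (fun m : MaximalSpectrum S => (restrictCont (k := k) m.asIdeal).toAddMonoidHom) m ν

theorem decompMap_bijective [DecidableEq (MaximalSpectrum S)] :
    Function.Bijective (decompMap k S) := by
  constructor
  · rw [injective_iff_map_eq_zero]
    classical
    intro ν hν
    choose N hN using fun m : MaximalSpectrum S =>
      exists_pow_le_of_contDual_localization m.asIdeal (ν m)
    have hcop : Pairwise (Function.onFun IsCoprime
        fun m : MaximalSpectrum S => m.asIdeal ^ N m) :=
      fun m m' h => (MaximalSpectrum.isCoprime_of_ne h).pow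
    have hsum : decompMap k S ν = ∑ m ∈ DFinsupp.support ν, restrictCont m.asIdeal (ν m) := by
      exact DFinsupp.sumAddHom_apply _ _
    refine DFinsupp.ext fun m => restrictCont_injective m.asIdeal ?_
    rw [DFinsupp.zero_apply, map_zero]
    by_cases hm : m ∈ DFinsupp.support ν
    swap
    · rw [DFinsupp.notMem_support_iff.1 hm, map_zero]
    obtain ⟨e, he1, he0⟩ := Ideal.exists_sub_one_mem_and_mem_of_coprime hcop
      (DFinsupp.support ν) m
    refine ContDual.ext fun x => ?_
    -- Evaluating the vanishing sum at `e * x` kills every term but the one at `m`, and that term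
    -- has the same value at `x` as at `e * x`.
    have h1 : restrictCont m.asIdeal (ν m) x = restrictCont m.asIdeal (ν m) (e * x) := by
      rw [← sub_eq_zero, ← map_sub]
      refine hN m _ ?_
      have : x - e * x = -(e - 1) * x := by ring
      rw [this]
      exact Ideal.mul_mem_right _ _ (neg_mem he1)
    let ev : ContDual k S →ₗ[k] k := Module.Dual.eval k S (e * x) ∘ₗ ContDual.incl k S
    have h2 : ∑ m' ∈ DFinsupp.support ν, ev (restrictCont m'.asIdeal (ν m')) = 0 := by
      rw [← map_sum, ← hsum, hν, map_zero]
    have h3 : ∑ m' ∈ DFinsupp.support ν, ev (restrictCont m'.asIdeal (ν m')) =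
        ev (restrictCont m.asIdeal (ν m)) :=
      Finset.sum_eq_single_of_mem m hm fun m' hm' hne =>
        hN m' _ (Ideal.mul_mem_right _ _ (he0 m' hm' hne))
    rw [h1]
    exact h3.symm.trans h2
  · intro μ
    induction μ using ContDual.induction_primary with
    | zero => exact ⟨0, map_zero _⟩
    | add μ ν hμ hν =>
      obtain ⟨a, rfl⟩ := hμ
      obtain ⟨c, rfl⟩ := hν
      exact ⟨a + c, map_add _ _ _⟩
    | primary μ m N hm _ h =>
      obtain ⟨ν, rfl⟩ := exists_restrictCont_eq m N μ h
      exact ⟨_, decompMap_of ⟨m, hm⟩ ν⟩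

end ContinuousDual
end CofreeCoalgebra

/-! ### Monomials and powers of the ideal of a point -/

namespace CofreeCoalgebra

section Residue

variable {k V : Type*} [Field k] [AddCommGroup V] [Module k V] {n : ℕ}
  (b : Module.Basis (Fin n) k V) (P : V)

/-- The ideal `𝔪_P = (z_1, …, z_n)` of the point `P`. -/
noncomputable def pointIdeal : Ideal (PolyRing k V) := Ideal.span (Set.range (localCoord b P))

theorem localCoord_mem_pointIdeal (i : Fin n) : localCoord b P i ∈ pointIdeal b P :=
  Ideal.subset_span ⟨i, rfl⟩

/-- For a coordinate in which the points differ, the two local coordinates differ by a nonzero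
constant, which can be scaled to `1`. -/
theorem isCoprime_pointIdeal {P Q : V} (h : P ≠ Q) :
    IsCoprime (pointIdeal b P) (pointIdeal b Q) := by
  obtain ⟨i, hi⟩ : ∃ i, b.coord i P ≠ b.coord i Q := by
    by_contra! h'
    exact h (b.ext_elem h')
  have hc : b.coord i Q - b.coord i P ≠ 0 := sub_ne_zero.2 hi.symm
  rw [Ideal.isCoprime_iff_exists]
  let c : PolyRing k V := algebraMap k _ (b.coord i Q - b.coord i P)⁻¹
  refine ⟨c * localCoord b P i, Ideal.mul_mem_left _ _ (localCoord_mem_pointIdeal b P i),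
    -c * localCoord b Q i, Ideal.mul_mem_left _ _ (localCoord_mem_pointIdeal b Q i), ?_⟩
  have : c * localCoord b P i + -c * localCoord b Q i =
      c * algebraMap k _ (b.coord i Q - b.coord i P) := by
    rw [map_sub, localCoord, localCoord]
    ring
  rw [this, ← map_mul, inv_mul_cancel₀ hc, map_one]

theorem localMonomial_zero : localMonomial b P 0 = 1 := by simp [localMonomial]

theorem localMonomial_add (a c : Fin n →₀ ℕ) :
    localMonomial b P (a + c) = localMonomial b P a * localMonomial b P c := by
  simp [localMonomial, pow_add, Finset.prod_mul_distrib]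

theorem localMonomial_single (i : Fin n) :
    localMonomial b P (Finsupp.single i 1) = localCoord b P i := by
  rw [localMonomial, Finset.prod_eq_single i]
  · simp
  · intro j _ hj
    simp [hj.symm]
  · simp

/-- The span is closed under products and contains the generators `x_i = z_i + x_i(P)`. Functionals
on `R` may therefore be compared on monomials centred at `P`. -/
theorem span_localMonomial : Submodule.span k (Set.range (localMonomial b P)) = ⊤ := by
  set N := Submodule.span k (Set.range (localMonomial b P)) with hN
  have h1 : (1 : PolyRing k V) ∈ N := Submodule.subset_span ⟨0, localMonomial_zero b P⟩
  have hmul : ∀ x ∈ N, ∀ y ∈ N, x * y ∈ N := by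
    intro x hx y hy
    have := Submodule.mul_mem_mul hx hy
    rw [hN, Submodule.span_mul_span] at this
    refine Submodule.span_mono ?_ this
    rintro _ ⟨_, ⟨a, rfl⟩, _, ⟨c, rfl⟩, rfl⟩
    exact ⟨a + c, localMonomial_add b P a c⟩
  rw [eq_top_iff]
  rintro r -
  induction r using SymmetricAlgebra.induction with
  | algebraMap c => rw [Algebra.algebraMap_eq_smul_one]; exact N.smul_mem c h1
  | ι f =>
    have hf : f = ∑ i, f (b i) • b.coord i := b.ext fun j => by simp
    rw [hf, map_sum]
    refine N.sum_mem fun i _ => ?_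
    have : SymmetricAlgebra.ι k (Module.Dual k V) (b.coord i) =
        localCoord b P i + algebraMap k (PolyRing k V) (b.coord i P) := by simp [localCoord]
    rw [map_smul, this, Algebra.algebraMap_eq_smul_one]
    exact N.smul_mem _ (N.add_mem (Submodule.subset_span ⟨_, localMonomial_single b P i⟩)
      (N.smul_mem _ h1))
  | mul x y hx hy => exact hmul x hx y hy
  | add x y hx hy => exact N.add_mem hx hy

theorem localMonomial_mem_pow {N : ℕ} {a : Fin n →₀ ℕ} {i : Fin n} (h : N ≤ a i) :
    localMonomial b P a ∈ pointIdeal b P ^ N := by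
  rw [localMonomial, ← Finset.mul_prod_erase _ _ (Finset.mem_univ i)]
  exact Ideal.mul_mem_right _ _
    (Ideal.pow_le_pow_right h (Ideal.pow_mem_pow (localCoord_mem_pointIdeal b P i) _))

/-- Outside the box some exponent exceeds `N`. The box is larger than necessary but finite, which is
all that the finiteness arguments need. -/
theorem localMonomial_mem_pow_of_notMem_Iic {N : ℕ} {a : Fin n →₀ ℕ}
    (h : a ∉ Finset.Iic (Finsupp.equivFunOnFinite.symm fun _ => N)) :
    localMonomial b P a ∈ pointIdeal b P ^ N := by
  rw [Finset.mem_Iic, Finsupp.le_def] at h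
  push Not at h
  obtain ⟨i, hi⟩ := h
  exact localMonomial_mem_pow b P (le_of_lt hi)

theorem finiteDimensional_quotient_pointIdeal_pow (N : ℕ) :
    FiniteDimensional k (PolyRing k V ⧸ pointIdeal b P ^ N) := by
  classical
  let π := (Ideal.Quotient.mkₐ k (pointIdeal b P ^ N)).toLinearMap
  have hπ : Function.Surjective π := Ideal.Quotient.mk_surjective
  let s : Finset (Fin n →₀ ℕ) := Finset.Iic (Finsupp.equivFunOnFinite.symm fun _ => N)
  refine Module.finite_def.2 ⟨s.image fun a => π (localMonomial b P a), ?_⟩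
  rw [eq_top_iff, ← LinearMap.range_eq_top.2 hπ, LinearMap.range_eq_map,
    ← span_localMonomial b P, Submodule.map_span, Submodule.span_le]
  rintro _ ⟨_, ⟨a, rfl⟩, rfl⟩
  by_cases ha : a ∈ s
  · exact Submodule.subset_span (Finset.mem_coe.2 (Finset.mem_image_of_mem _ ha))
  · have : π (localMonomial b P a) = 0 :=
      Ideal.Quotient.eq_zero_iff_mem.2 (localMonomial_mem_pow_of_notMem_Iic b P ha)
    rw [this]
    exact zero_mem _

/-- Multiplication by `z_i` lowers `a_i` by one, or kills `F_a` if `a_i = 0`. Each factor from `𝔪_P`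
thus uses up one unit of degree, and `d + 1` factors exhaust it. -/
theorem smul_genFrac_eq_zero (d : ℕ) : ∀ a : Fin n →₀ ℕ, a.degree ≤ d →
    ∀ x ∈ pointIdeal b P ^ (d + 1), x • genFrac b P a = 0 := by
  induction d with
  | zero =>
    intro a ha x hx
    have ha' : a = 0 := (Finsupp.degree_eq_zero_iff a).1 (Nat.le_zero.1 ha)
    rw [zero_add, pow_one] at hx
    refine Submodule.span_induction ?_ (zero_smul _ _) ?_ ?_ hx
    · rintro _ ⟨i, rfl⟩
      exact localCoord_smul_genFrac_of_eq_zero b P i a (by simp [ha'])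
    · intro x y _ _ hx hy
      rw [add_smul, hx, hy, add_zero]
    · intro r x _ hx
      rw [smul_assoc, hx, smul_zero]
  | succ d ih =>
    intro a ha x hx
    rw [pow_succ] at hx
    refine Submodule.mul_induction_on hx ?_ ?_
    · intro y hy z hz
      refine Submodule.span_induction (p := fun z _ => (y * z) • genFrac b P a = 0)
        ?_ ?_ ?_ ?_ hz
      · rintro _ ⟨i, rfl⟩
        rw [mul_smul]
        by_cases h : a i = 0
        · rw [localCoord_smul_genFrac_of_eq_zero b P i a h, smul_zero]
        · obtain ⟨c, rfl⟩ : ∃ c, a = c + Finsupp.single i 1 :=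
            ⟨a - Finsupp.single i 1,
              (tsub_add_cancel_of_le (by simpa [Nat.one_le_iff_ne_zero] using h)).symm⟩
          rw [localCoord_smul_genFrac]
          refine ih c ?_ y hy
          simpa using ha
      · rw [mul_zero, zero_smul]
      · intro x y _ _ hx hy
        rw [mul_add, add_smul, hx, hy, add_zero]
      · intro r x _ hx
        rw [smul_eq_mul, mul_left_comm, mul_smul, hx, smul_zero]
    · intro x y hx hy
      rw [add_smul, hx, hy, add_zero]

/-- Every element of `H_P` is annihilated by a power of `𝔪_P`. -/
theorem LC.exists_pow_smul_eq_zero (η : LC b P) :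
    ∃ N : ℕ, ∀ x ∈ pointIdeal b P ^ N, x • η = 0 := by
  have hη : η ∈ Submodule.span k (Set.range (genFrac b P)) := by
    rw [span_genFrac]; trivial
  induction hη using Submodule.span_induction with
  | mem x hx =>
    obtain ⟨a, rfl⟩ := hx
    exact ⟨_, smul_genFrac_eq_zero b P _ a le_rfl⟩
  | zero => exact ⟨0, fun x _ => smul_zero x⟩
  | add η θ _ _ hη hθ =>
    obtain ⟨N, hN⟩ := hη
    obtain ⟨M, hM⟩ := hθ
    refine ⟨max N M, fun x hx => ?_⟩
    rw [smul_add, hN x (Ideal.pow_le_pow_right (le_max_left _ _) hx),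
      hM x (Ideal.pow_le_pow_right (le_max_right _ _) hx), add_zero]
  | smul c η _ hη =>
    obtain ⟨N, hN⟩ := hη
    exact ⟨N, fun x hx => by rw [smul_comm, hN x hx, smul_zero]⟩

/-! ### The residue pairing at a point -/

/-- The map `H_P → Hom_k^cont(R, k)` sending `η` to `r ↦ Res_P(r η)`. -/
noncomputable def resPairing : LC b P →ₗ[k] ContDual k (PolyRing k V) where
  toFun η := ⟨res b P ∘ₗ (LinearMap.toSpanSingleton (PolyRing k V) _ η).restrictScalars k, by
    obtain ⟨N, hN⟩ := LC.exists_pow_smul_eq_zero b P η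
    refine ⟨pointIdeal b P ^ N, finiteDimensional_quotient_pointIdeal_pow b P N, fun x hx => ?_⟩
    change res b P (x • η) = 0
    rw [hN x hx, map_zero]⟩
  map_add' η θ := ContDual.ext fun r =>
    (congrArg (res b P) (smul_add r η θ)).trans (map_add _ _ _)
  map_smul' c η := ContDual.ext fun r =>
    (congrArg (res b P) (smul_comm r c η)).trans (map_smul _ _ _)

theorem resPairing_apply (η : LC b P) (r : PolyRing k V) :
    resPairing b P η r = res b P (r • η) := rfl

theorem contDual_ext_localMonomial {μ ν : ContDual k (PolyRing k V)}
    (h : ∀ a, μ (localMonomial b P a) = ν (localMonomial b P a)) : μ = ν :=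
  ContDual.incl_injective (LinearMap.ext_on_range (span_localMonomial b P) h)

/-- The duality `Res_P(z^a F_c) = δ_{ac}` extended linearly: the functional attached to `η` records
all coordinates of `η`, whence injectivity of `resPairing`. -/
theorem res_localMonomial_smul (a : Fin n →₀ ℕ) (η : LC b P) :
    res b P (localMonomial b P a • η) = (LC.basis b P).repr η a := by
  classical
  have : (res b P ∘ₗ (LinearMap.lsmul (PolyRing k V) (LC b P)
      (localMonomial b P a)).restrictScalars k) =
      Finsupp.lapply a ∘ₗ (LC.basis b P).repr.toLinearMap := by
    refine (LC.basis b P).ext fun c => ?_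
    have h := res_localMonomial_smul_genFrac b P a c
    rw [← LC.basis_apply] at h
    refine h.trans ?_
    simp [Finsupp.single_apply, eq_comm]
  exact LinearMap.congr_fun this η

theorem resPairing_injective : Function.Injective (resPairing b P) := by
  intro η θ h
  refine (LC.basis b P).repr.injective (Finsupp.ext fun a => ?_)
  rw [← res_localMonomial_smul, ← res_localMonomial_smul, ← resPairing_apply, h,
    resPairing_apply]

/-- By duality the coefficient of `F_c` has to be `μ (z^c)`. Vanishing of `μ` on `𝔪_P ^ N` makes the
sum over the box exhaust all nonzero coefficients. -/
theorem exists_resPairing_eq (μ : ContDual k (PolyRing k V)) (N : ℕ)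
    (hμ : ∀ x ∈ pointIdeal b P ^ N, μ x = 0) : ∃ η, resPairing b P η = μ := by
  classical
  let s : Finset (Fin n →₀ ℕ) := Finset.Iic (Finsupp.equivFunOnFinite.symm fun _ => N)
  refine ⟨∑ c ∈ s, μ (localMonomial b P c) • genFrac b P c,
    contDual_ext_localMonomial b P fun a => ?_⟩
  rw [resPairing_apply, Finset.smul_sum, map_sum]
  simp only [smul_comm (localMonomial b P a) (_ : k), map_smul, res_localMonomial_smul_genFrac,
    smul_eq_mul, mul_ite, mul_one, mul_zero, Finset.sum_ite_eq]
  split_ifs with ha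
  · rfl
  · exact (hμ _ (localMonomial_mem_pow_of_notMem_Iic b P ha)).symm

/-- The residue field is finite over the algebraically closed `k`, hence equal to `k`. The
coordinates of `P` are the residues of the `x_i`. -/
theorem exists_pointIdeal_le [IsAlgClosed k] (m : Ideal (PolyRing k V)) (hm : m.IsMaximal)
    [FiniteDimensional k (PolyRing k V ⧸ m)] : ∃ P, pointIdeal b P ≤ m := by
  have hbij : Function.Bijective (algebraMap k (PolyRing k V ⧸ m)) :=
    IsAlgClosed.algebraMap_bijective_of_isIntegral
  choose p hp using fun i => hbij.2
    (Ideal.Quotient.mk m (SymmetricAlgebra.ι k (Module.Dual k V) (b.coord i)))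
  refine ⟨∑ i, p i • b i, Ideal.span_le.2 ?_⟩
  rintro _ ⟨i, rfl⟩
  refine Ideal.Quotient.eq_zero_iff_mem.1 ?_
  have : b.coord i (∑ j, p j • b j) = p i := by simp [Finsupp.single_apply]
  rw [localCoord, map_sub, this, ← hp i]
  exact sub_self _

/-! ### Compatibility with the coalgebra structures -/

/-- Both sides are linear in `x`, `y` and `η`. For `z^u`, `z^v` and `F_a` each of them is `1` if `u
+ v = a` and `0` otherwise. -/
theorem contPairing_map_resPairing_comul (η : LC b P) (x y : PolyRing k V) :
    contPairing k (PolyRing k V) (TensorProduct.map (resPairing b P) (resPairing b P)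
      (Coalgebra.comul (R := k) η)) (x ⊗ₜ y) = res b P ((x * y) • η) := by
  have hfun : ∀ u v, contPairing k (PolyRing k V) (TensorProduct.map (resPairing b P)
      (resPairing b P) (Coalgebra.comul (R := k) η))
      (localMonomial b P u ⊗ₜ localMonomial b P v) =
      res b P ((localMonomial b P u * localMonomial b P v) • η) := by
    classical
    intro u v
    rw [← localMonomial_add]
    have key : Module.Dual.eval k _ (localMonomial b P u ⊗ₜ localMonomial b P v) ∘ₗ
        contPairing k (PolyRing k V) ∘ₗ TensorProduct.map (resPairing b P) (resPairing b P) ∘ₗ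
          Coalgebra.comul (R := k) = res b P ∘ₗ (LinearMap.lsmul (PolyRing k V) (LC b P)
      (localMonomial b P (u + v))).restrictScalars k := by
      refine (LC.basis b P).ext fun a => ?_
      rw [LC.basis_apply]
      refine Eq.trans ?_ (res_localMonomial_smul_genFrac b P (u + v) a).symm
      simp only [LinearMap.comp_apply, LC.comul_genFrac, map_sum, TensorProduct.map_tmul]
      -- Among the terms of `Δ F_a` only `F_u ⊗ F_v` pairs nontrivially with `z^u ⊗ z^v`, and it
      -- occurs exactly when `(u, v)` is in the antidiagonal of `a`.
      have hterm : ∀ c : (Fin n →₀ ℕ) × (Fin n →₀ ℕ), Module.Dual.eval k _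
          (localMonomial b P u ⊗ₜ[k] localMonomial b P v) (contPairing k (PolyRing k V)
            (resPairing b P (genFrac b P c.1) ⊗ₜ[k] resPairing b P (genFrac b P c.2))) =
          if c = (u, v) then 1 else 0 := by
        rintro ⟨c, d⟩
        have : (if u = c then (1 : k) else 0) * (if v = d then 1 else 0) =
            if (c, d) = (u, v) then 1 else 0 := by
          by_cases h1 : u = c <;> by_cases h2 : v = d <;> simp [h1, h2, eq_comm]
        rw [← this, ← res_localMonomial_smul_genFrac b P u c,
          ← res_localMonomial_smul_genFrac b P v d]
        simp [contPairing, resPairing_apply]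
      simp only [hterm, Finset.sum_ite_eq']
      exact if_congr Finset.HasAntidiagonal.mem_antidiagonal rfl rfl
    exact LinearMap.congr_fun key η
  have hx : ∀ x v, contPairing k (PolyRing k V) (TensorProduct.map (resPairing b P)
      (resPairing b P) (Coalgebra.comul (R := k) η)) (x ⊗ₜ localMonomial b P v) =
      res b P ((x * localMonomial b P v) • η) := by
    intro x v
    have hx : x ∈ Submodule.span k (Set.range (localMonomial b P)) := by
      rw [span_localMonomial]; trivial
    induction hx using Submodule.span_induction with
    | mem x hx => obtain ⟨u, rfl⟩ := hx; exact hfun u v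
    | zero => simp
    | add x y _ _ hx hy => simp only [TensorProduct.add_tmul, map_add, add_mul, add_smul, hx, hy]
    | smul c x _ hx => rw [← TensorProduct.smul_tmul', map_smul, hx, smul_mul_assoc, smul_assoc,
        (res b P).map_smul]
  have hy : y ∈ Submodule.span k (Set.range (localMonomial b P)) := by
    rw [span_localMonomial]; trivial
  induction hy using Submodule.span_induction with
  | mem y hy => obtain ⟨u, rfl⟩ := hy; exact hx x u
  | zero => simp
  | add y z _ _ hy hz => simp only [TensorProduct.tmul_add, map_add, mul_add, add_smul, hy, hz]
  | smul c y _ hy => rw [TensorProduct.tmul_smul, map_smul, hy, mul_smul_comm, smul_assoc,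
      (res b P).map_smul]

/-- A tensor of continuous functionals is determined by its values on `x ⊗ y`, and the coproduct of
`μ` is characterized by the values `μ (x * y)`. -/
theorem map_resPairing_comul (η : LC b P) :
    TensorProduct.map (resPairing b P) (resPairing b P) (Coalgebra.comul (R := k) η) =
      Coalgebra.comul (R := k) (resPairing b P η) := by
  refine contPairing_injective (TensorProduct.ext' fun x y => ?_)
  rw [contPairing_map_resPairing_comul]
  exact (contPairing_contComul_tmul (resPairing b P η) x y).symm

theorem counit_resPairing (η : LC b P) :
    Coalgebra.counit (R := k) (resPairing b P η) = Coalgebra.counit (R := k) η :=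
  congrArg (res b P) (one_smul (PolyRing k V) η)

/-! ### The global map, summed over all points -/

variable [DecidableEq V]

/-- The map `!V → Hom_k^cont(R, k)` sending `η` to `r ↦ Res(r η)`, as a map of coalgebras. -/
noncomputable def bangMap : Bang b →ₗc[k] ContDual k (PolyRing k V) where
  toLinearMap := DFinsupp.lsum k (resPairing b)
  counit_comp := by
    refine DFinsupp.lhom_ext fun P η => ?_
    simp only [LinearMap.comp_apply, DFinsupp.lsum_single, counit_resPairing,
      DFinsupp.counit_single]
  map_comp_comul := by
    refine DFinsupp.lhom_ext fun P η => ?_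
    simp only [LinearMap.comp_apply, DFinsupp.lsum_single, DFinsupp.comul_single]
    -- On the summand at `P` the coproduct is that of `H_P` followed by the inclusion on both
    -- factors, and the inclusion followed by the sum map is `resPairing b P`.
    rw [← map_resPairing_comul, ← LinearMap.comp_apply, ← TensorProduct.map_comp]
    congr 2 <;> ext <;> simp

theorem bangMap_single (η : LC b P) : bangMap b (DFinsupp.single P η) = resPairing b P η :=
  DFinsupp.lsum_single _ _ _ _

theorem bangMap_apply (η : Bang b) (r : PolyRing k V) :
    bangMap b η r = totalRes b (r • η) := by
  induction η using DFinsupp.induction with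
  | h0 => simp
  | ha P x η _ _ ih =>
    rw [map_add, smul_add, map_add, map_add, LinearMap.add_apply, ih, bangMap_single,
      resPairing_apply, ← DFinsupp.single_smul, totalRes, DFinsupp.lsum_single]

theorem bangMap_eq_sum [∀ P (η : LC b P), Decidable (η ≠ 0)] (η : Bang b) :
    bangMap b η = ∑ P ∈ η.support, resPairing b P (η P) :=
  DFinsupp.sumAddHom_apply (fun P => (resPairing b P).toAddMonoidHom) η

/-- Each component is annihilated by a power of its own `𝔪_P`, and these powers are coprime for
distinct points. An element `e` as in the Chinese remainder theorem acts as `1` on the component at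
`P` and as `0` on the others in the support. -/
theorem bangMap_injective : Function.Injective (bangMap b) := by
  classical
  rw [injective_iff_map_eq_zero]
  intro η hη
  choose N hN using fun P => LC.exists_pow_smul_eq_zero b P (η P)
  have hcop : Pairwise (Function.onFun IsCoprime fun P => pointIdeal b P ^ N P) :=
    fun P Q h => (isCoprime_pointIdeal b h).pow
  refine DFinsupp.ext fun P => resPairing_injective b P ?_
  rw [DFinsupp.zero_apply, map_zero]
  by_cases hP : P ∈ η.support
  swap
  · rw [DFinsupp.notMem_support_iff.1 hP, map_zero]
  obtain ⟨e, he1, he0⟩ := Ideal.exists_sub_one_mem_and_mem_of_coprime hcop η.support P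
  refine ContDual.ext fun x => ?_
  let ev : ContDual k (PolyRing k V) →ₗ[k] k :=
    Module.Dual.eval k _ (e * x) ∘ₗ ContDual.incl k (PolyRing k V)
  have hsum : ∑ Q ∈ η.support, ev (resPairing b Q (η Q)) = 0 := by
    rw [← map_sum, ← bangMap_eq_sum, hη, map_zero]
  rw [Finset.sum_eq_single_of_mem P hP fun Q hQ hne => ?_] at hsum
  · refine Eq.trans ?_ hsum
    change res b P (x • η P) = res b P ((e * x) • η P)
    have hx : e * x = x + (e - 1) * x := by ring
    rw [hx, add_smul, hN P _ (Ideal.mul_mem_right _ _ he1), add_zero]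
  · change res b Q ((e * x) • η Q) = 0
    rw [hN Q _ (Ideal.mul_mem_right _ _ (he0 Q hQ hne)), map_zero]

theorem bangMap_surjective [IsAlgClosed k] : Function.Surjective (bangMap b) := by
  intro μ
  induction μ using ContDual.induction_primary with
  | zero => exact ⟨0, map_zero _⟩
  | add μ ν hμ hν =>
    obtain ⟨x, rfl⟩ := hμ
    obtain ⟨y, rfl⟩ := hν
    exact ⟨x + y, map_add _ _ _⟩
  | primary μ m N hm hfin h =>
    obtain ⟨P, hP⟩ := exists_pointIdeal_le b m hm
    -- The inclusion `𝔪_P ≤ m` suffices here: it puts `𝔪_P ^ N` inside `m ^ N`, where `μ` vanishes.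
    obtain ⟨η, rfl⟩ := exists_resPairing_eq b P μ N fun x hx => h x (Ideal.pow_right_mono hP N hx)
    exact ⟨_, bangMap_single b P η⟩

end Residue
end CofreeCoalgebra

theorem lemmaA1 {k V : Type*} [Field k] [IsAlgClosed k] [CharZero k]
    [AddCommGroup V] [Module k V] [FiniteDimensional k V]
    [DecidableEq V] [DecidableEq (MaximalSpectrum (CofreeCoalgebra.PolyRing k V))] :
    Function.Bijective (CofreeCoalgebra.decompMap k (CofreeCoalgebra.PolyRing k V)) ∧
    ∀ {n : ℕ} (b : Module.Basis (Fin n) k V),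
      ∃ e : CofreeCoalgebra.Bang b ≃ₗc[k] CofreeCoalgebra.ContDual k (CofreeCoalgebra.PolyRing k V),
        ∀ (η : CofreeCoalgebra.Bang b) (r : CofreeCoalgebra.PolyRing k V),
          e η r = CofreeCoalgebra.totalRes b (r • η) :=
  ⟨CofreeCoalgebra.decompMap_bijective, fun b =>
    ⟨CoalgEquiv.ofBijective (f := CofreeCoalgebra.bangMap b)
      ⟨CofreeCoalgebra.bangMap_injective b, CofreeCoalgebra.bangMap_surjective b⟩,
      CofreeCoalgebra.bangMap_apply b⟩⟩
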